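/- Let $R$ be an Artin algebra, that is, an algebra over a commutative Artinian ring $A$ which is finitely generated as an $A$-module. For a left or right module $M$ let $0\to M\to E^0(M)\to E^1(M)\to\cdots$ be its minimal injective coresolution, and for integers $n,k\ge 0$ call $M$ a $G_n(k)$-module if the flat dimension of $E^i(M)$ is at most $k+i$ for all $0\le i\le n-1$. Let $n,k\ge 0$ and assume that both the left module ${}_RR$ and the right module $R_R$ are $G_n(k)$-modules. Then for every left $R$-module $M$ (not necessarily finitely generated) there are left $R$-modules $I_j(M),G_j(M),I^j(M),G^j(M)$, each depending only on $j$ and $M$, such that for every $1\le i\le n-1$ there are commutative diagrams with exact rows $$\begin{array}{ccccccccc}0&\to&M&\to&I_{i+1}(M)&\to&G_{i+1}(M)&\to&0\\&&\|&&\downarrow&&\downarrow&&\\0&\to&M&\to&I_i(M)&\to&G_i(M)&\to&0\end{array}$$ and $$\begin{array}{ccccccccc}0&\to&I^{i+1}(M)&\to&G^{i+1}(M)&\to&M&\to&0\\&&\downarrow&&\downarrow&&\|&&\\0&\to&I^i(M)&\to&G^i(M)&\to&M&\to&0\end{array}$$ (the row with a given index $j$ being the same in all diagrams of its kind in which it occurs),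 in which all vertical maps are surjective, and such that for $j=i,i+1$ the modules $G_j(M)$ and $G^j(M)$ are $G_j(k)$-modules and the modules $I_j(M)$ and $I^j(M)$ have injective dimension at most $j+k$. -/

import Mathlib

universe u

open scoped TensorProduct

namespace AuslanderType

/-! Left modules over a ring `R` are `Module R`; right `R`-modules are modules over `Rᵐᵒᵖ`. -/

section Flat

variable (R : Type u) [Ring R]

/-- For a right `R`-module `N` and a left `R`-module `M`, the subgroup of `N ⊗[ℤ] M` generated by
all `(n r) ⊗ m - n ⊗ (r m)`. -/
def balancedRel (N M : Type u) [AddCommGroup N] [Module Rᵐᵒᵖ N] [AddCommGroup M] [Module R M] :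
    AddSubgroup (N ⊗[ℤ] M) :=
  AddSubgroup.closure
    {x | ∃ (n : N) (r : R) (m : M), x = (MulOpposite.op r • n) ⊗ₜ[ℤ] m - n ⊗ₜ[ℤ] (r • m)}

/-- The tensor product `N ⊗_R M` of a right module and a left module over a not necessarily
commutative ring, as an abelian group. -/
abbrev BalancedTensor (N M : Type u) [AddCommGroup N] [Module Rᵐᵒᵖ N]
    [AddCommGroup M] [Module R M] : Type u :=
  (N ⊗[ℤ] M) ⧸ balancedRel R N M

variable {N N' : Type u} [AddCommGroup N] [Module Rᵐᵒᵖ N] [AddCommGroup N'] [Module Rᵐᵒᵖ N']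

/-- The map `f ⊗_ℤ M : N ⊗[ℤ] M → N' ⊗[ℤ] M` on the tensor products of abelian groups. -/
def intTensorMap (M : Type u) [AddCommGroup M] (f : N →ₗ[Rᵐᵒᵖ] N') : N ⊗[ℤ] M →+ N' ⊗[ℤ] M :=
  (f.toAddMonoidHom.toIntLinearMap.rTensor M).toAddMonoidHom

theorem intTensorMap_tmul (M : Type u) [AddCommGroup M] (f : N →ₗ[Rᵐᵒᵖ] N') (n : N) (m : M) :
    intTensorMap R M f (n ⊗ₜ[ℤ] m) = f n ⊗ₜ[ℤ] m :=
  rfl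

theorem balancedRel_le_comap (M : Type u) [AddCommGroup M] [Module R M] (f : N →ₗ[Rᵐᵒᵖ] N') :
    balancedRel R N M ≤ (balancedRel R N' M).comap (intTensorMap R M f) := by
  refine (AddSubgroup.closure_le _).2 ?_
  rintro _ ⟨n, r, m, rfl⟩
  refine AddSubgroup.subset_closure ⟨f n, r, m, ?_⟩
  rw [map_sub, intTensorMap_tmul, intTensorMap_tmul, map_smul]

/-- The map `f ⊗_R M : N ⊗_R M → N' ⊗_R M` induced by a homomorphism `f` of right modules. -/
def BalancedTensor.map (M : Type u) [AddCommGroup M] [Module R M] (f : N →ₗ[Rᵐᵒᵖ] N') :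
    BalancedTensor R N M →+ BalancedTensor R N' M :=
  QuotientAddGroup.map _ _ (intTensorMap R M f) (balancedRel_le_comap R M f)

/-- A left `R`-module `M` is flat if `- ⊗_R M` preserves injections of right `R`-modules. -/
def IsFlat (M : Type u) [AddCommGroup M] [Module R M] : Prop :=
  ∀ (N N' : Type u) [AddCommGroup N] [Module Rᵐᵒᵖ N] [AddCommGroup N'] [Module Rᵐᵒᵖ N']
    (f : N →ₗ[Rᵐᵒᵖ] N'), Function.Injective f → Function.Injective (BalancedTensor.map R M f)

/-- The flat dimension of `M` is at most `n`: there is an exact sequence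
`0 → F_n → ⋯ → F_1 → F_0 → M → 0` with all `F_i` flat (built one syzygy at a time). -/
def FlatDimLE : ℕ → ∀ (M : Type u) [AddCommGroup M] [Module R M], Prop
  | 0, M, _, _ => IsFlat R M
  | n + 1, M, _, _ => ∃ (F : ModuleCat.{u} R) (p : F →ₗ[R] M),
      IsFlat R F ∧ Function.Surjective p ∧ FlatDimLE n (LinearMap.ker p)

end Flat

section Injective

variable (R : Type u) [Ring R]

/-- `f : M → E` is an injective envelope: `E` is injective, every homomorphism from `M` to an
injective module factors through `f`, and `f` is left minimal. -/
structure IsInjectiveEnvelope {M E : Type u} [AddCommGroup M] [Module R M]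
    [AddCommGroup E] [Module R E] (f : M →ₗ[R] E) : Prop where
  injective : Module.Injective R E
  factors : ∀ (E' : Type u) [AddCommGroup E'] [Module R E'], Module.Injective R E' →
    ∀ g : M →ₗ[R] E', ∃ h : E →ₗ[R] E', h ∘ₗ f = g
  left_minimal : ∀ h : E →ₗ[R] E, h ∘ₗ f = f → Function.Bijective h

/-- A minimal injective coresolution `0 → M → E 0 → E 1 → ⋯`. -/
structure MinimalInjectiveCoresolution (M : Type u) [AddCommGroup M] [Module R M] where
  E : ℕ → ModuleCat.{u} R
  ε : M →ₗ[R] E 0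
  d : ∀ i, E i →ₗ[R] E (i + 1)
  injective_ε : Function.Injective ε
  exact_zero : Function.Exact ε (d 0)
  exact_succ : ∀ i, Function.Exact (d i) (d (i + 1))
  envelope_zero : IsInjectiveEnvelope R ε
  envelope_succ : ∀ i, IsInjectiveEnvelope R (LinearMap.range (d i)).subtype

/-- `M` is `G_n(k)`: the `i`-th term of a minimal injective coresolution of `M` has flat dimension
at most `k + i`, for `0 ≤ i ≤ n - 1`. -/
def IsG (n k : ℕ) (M : Type u) [AddCommGroup M] [Module R M] : Prop :=
  ∃ C : MinimalInjectiveCoresolution R M, ∀ i, i < n → FlatDimLE R (k + i) (C.E i)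

end Injective

/-- `0 → X → Y → Z → 0` is exact. -/
def IsShortExact {R : Type u} [Ring R] {X Y Z : Type u} [AddCommGroup X] [Module R X]
    [AddCommGroup Y] [Module R Y] [AddCommGroup Z] [Module R Z]
    (f : X →ₗ[R] Y) (g : Y →ₗ[R] Z) : Prop :=
  Function.Injective f ∧ Function.Exact f g ∧ Function.Surjective g

end AuslanderType

/-!
Character modules `N* = Hom_ℤ(N, ℚ/ℤ)` exchange flat and injective dimension over Noetherian rings.
If `N` is a flat right module that is `G_n(k)`, then the dual of its minimal injective coresolution
is a flat resolution `⋯ → (E¹)* → (E⁰)* → N* → 0` of an injective left module, and the `j`-th syzygy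
`K_j` of `N*` in it has injective dimension at most `k + j` for `j ≤ n`.

Every left module embeds in such an `N*`. Flat modules lift along surjections whose kernel is a
character module, since these split over flat modules, so the horseshoe lemma is available for
resolutions by flat modules. Given an embedding `X → N*` and a `j`-th flat syzygy `G` of `X`, it
yields a `(j + 1)`-st flat syzygy `G'` of `N* / X` and a surjection `G' → G` with kernel `K_{j+1}`.
Starting from `G = X = M` and iterating produces the second tower. Its terms are `G_j(k)`, because
flat left modules are `G_n(k)` and a `j`-th syzygy loses nothing up to level `j`. The first tower is
the pullback of the second tower of `E / M` along `E → E / M`, for `E` an injective module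
containing `M`.
-/

namespace AuslanderType

open CategoryTheory

section Factorization

variable {S X Y Z : Type*} [Ring S] [AddCommGroup X] [Module S X] [AddCommGroup Y] [Module S Y]
  [AddCommGroup Z] [Module S Z]

theorem exists_comp_eq_of_baer (hZ : Module.Baer S Z) (g : X →ₗ[S] Y) (ν : X →ₗ[S] Z)
    (h : LinearMap.ker g ≤ LinearMap.ker ν) : ∃ μ : Y →ₗ[S] Z, μ ∘ₗ g = ν := by
  obtain ⟨μ, hμ⟩ := hZ.extension_property ((LinearMap.ker g).liftQ g le_rfl)
    (LinearMap.ker_eq_bot.1 (Submodule.ker_liftQ_eq_bot _ _ _ le_rfl))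
    ((LinearMap.ker g).liftQ ν h)
  exact ⟨μ, LinearMap.ext fun x => DFunLike.congr_fun hμ (Submodule.Quotient.mk x)⟩

theorem exists_addMonoidHom_comp_eq {A B Q : Type*} [AddCommGroup A] [AddCommGroup B]
    [AddCommGroup Q] [DivisibleBy Q ℤ] (g : A →+ B) (ν : A →+ Q)
    (h : ∀ a, g a = 0 → ν a = 0) : ∃ μ : B →+ Q, ∀ a, μ (g a) = ν a := by
  obtain ⟨μ, hμ⟩ :=
    exists_comp_eq_of_baer (.of_divisible Q) g.toIntLinearMap ν.toIntLinearMap h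
  exact ⟨μ.toAddMonoidHom, DFunLike.congr_fun hμ⟩

end Factorization

section CharDual

variable {R S : Type u} [Ring R] [Ring S]

/-- For an isomorphism `σ : R ≃+* Sᵐᵒᵖ` and a left `S`-module `N`, the group of characters of `N`
as a left `R`-module. Carrying `σ` around, instead of using `R = Sᵐᵒᵖ`, treats duals of left and of
right modules alike, and makes the double dual of an `S`-module an `S`-module. -/
def CharDual (_σ : R ≃+* Sᵐᵒᵖ) (N : Type u) [AddCommGroup N] : Type u := CharacterModule N

/-- The isomorphism opposite to `σ`, which turns characters of `R`-modules into `S`-modules. -/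
def swapOp (σ : R ≃+* Sᵐᵒᵖ) : S ≃+* Rᵐᵒᵖ := (RingEquiv.opOp S).trans σ.symm.op

namespace CharDual

variable {σ : R ≃+* Sᵐᵒᵖ} {N N' N'' : Type u} [AddCommGroup N] [AddCommGroup N']
  [AddCommGroup N'']

instance : AddCommGroup (CharDual σ N) := inferInstanceAs (AddCommGroup (CharacterModule N))

instance : FunLike (CharDual σ N) N (AddCircle (1 : ℚ)) :=
  inferInstanceAs (FunLike (CharacterModule N) N _)

instance : AddMonoidHomClass (CharDual σ N) N (AddCircle (1 : ℚ)) :=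
  inferInstanceAs (AddMonoidHomClass (CharacterModule N) N _)

@[ext] theorem ext {φ ψ : CharDual σ N} (h : ∀ n, φ n = ψ n) : φ = ψ := DFunLike.ext _ _ h

@[simp] theorem add_apply (φ ψ : CharDual σ N) (n : N) : (φ + ψ) n = φ n + ψ n := rfl

@[simp] theorem zero_apply (n : N) : (0 : CharDual σ N) n = 0 := rfl

theorem sum_apply {ι : Type*} (s : Finset ι) (φ : ι → CharDual σ N) (n : N) :
    (∑ i ∈ s, φ i) n = ∑ i ∈ s, φ i n :=
  map_sum (AddMonoidHom.eval n : (N →+ AddCircle (1 : ℚ)) →+ _) φ s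

variable [Module S N] [Module S N'] [Module S N'']

instance : Module R (CharDual σ N) where
  smul r φ := AddMonoidHom.comp (φ : N →+ _) (DistribSMul.toAddMonoidHom N (σ r).unop)
  one_smul φ := ext fun n => congrArg φ (by simp)
  mul_smul r s φ := ext fun n => congrArg φ (by simp [mul_smul])
  smul_zero _ := rfl
  smul_add _ _ _ := rfl
  add_smul r s φ := ext fun n => (congrArg φ (by simp [add_smul])).trans (map_add φ _ _)
  zero_smul φ := ext fun n => (congrArg φ (by simp)).trans (map_zero φ)

@[simp] theorem smul_apply (r : R) (φ : CharDual σ N) (n : N) :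
    (r • φ) n = φ ((σ r).unop • n) := rfl

theorem unop_swapOp_smul_apply (s : S) (φ : CharDual σ N) (n : N) :
    ((swapOp σ s).unop • φ) n = φ (s • n) := by
  change φ ((σ (σ.symm (.op s))).unop • n) = _
  rw [RingEquiv.apply_symm_apply, MulOpposite.unop_op]

/-- Precomposition of characters with a homomorphism. -/
def map (σ : R ≃+* Sᵐᵒᵖ) (f : N →ₗ[S] N') : CharDual σ N' →ₗ[R] CharDual σ N where
  toFun φ := AddMonoidHom.comp (φ : N' →+ _) f.toAddMonoidHom
  map_add' _ _ := rfl
  map_smul' r φ := ext fun n => congrArg φ (f.map_smul (σ r).unop n).symm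

theorem map_comp (g : N' →ₗ[S] N'') (f : N →ₗ[S] N') : map σ (g ∘ₗ f) = map σ f ∘ₗ map σ g := rfl

theorem map_id : map σ (LinearMap.id : N →ₗ[S] N) = LinearMap.id := rfl

theorem map_injective {f : N →ₗ[S] N'} (hf : Function.Surjective f) :
    Function.Injective (map σ f) := fun φ ψ h => ext fun n => by
  obtain ⟨n, rfl⟩ := hf n
  exact DFunLike.congr_fun h n

theorem map_exact {f : N →ₗ[S] N'} {g : N' →ₗ[S] N''} (hfg : Function.Exact f g) :
    Function.Exact (map σ g) (map σ f) := fun φ => by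
  constructor
  · intro h
    obtain ⟨ψ, hψ⟩ := exists_addMonoidHom_comp_eq g.toAddMonoidHom (φ : N' →+ _) fun x hx => by
      obtain ⟨n, rfl⟩ := (hfg x).1 hx
      exact DFunLike.congr_fun h n
    exact ⟨ψ, ext hψ⟩
  · rintro ⟨ψ, rfl⟩
    ext n
    exact (congrArg ψ (hfg.apply_apply_eq_zero n)).trans (map_zero ψ)

theorem map_surjective {f : N →ₗ[S] N'} (hf : Function.Injective f) :
    Function.Surjective (map σ f) := by
  have hker : Function.Exact (0 : N →ₗ[S] N) f := by
    rw [LinearMap.exact_iff, LinearMap.ker_eq_bot.2 hf, LinearMap.range_zero]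
  exact fun φ => (map_exact hker φ).1 (ext fun _ => map_zero φ)

theorem isShortExact_map {f : N →ₗ[S] N'} {g : N' →ₗ[S] N''} (h : IsShortExact f g) :
    IsShortExact (map σ g) (map σ f) :=
  ⟨map_injective h.2.2, map_exact h.2.1, map_surjective h.1⟩

/-- The homomorphism `V → C*` corresponding to `C → V*`: both encode a pairing of `C` and `V`. -/
def flip {C V : Type u} [AddCommGroup C] [Module R C] [AddCommGroup V] [Module S V]
    (f : C →ₗ[R] CharDual σ V) : V →ₗ[S] CharDual (swapOp σ) C where
  toFun v := AddMonoidHom.mk' (fun c => f c v) fun c c' => by simp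
  map_add' v v' := ext fun c => map_add (f c) v v'
  map_smul' s v := ext fun c => by
    change f c (s • v) = f (σ.symm (.op s) • c) v
    simp

/-- The evaluation homomorphism of `N` into its double dual. -/
def eval (σ : R ≃+* Sᵐᵒᵖ) (N : Type u) [AddCommGroup N] [Module S N] :
    N →ₗ[S] CharDual (swapOp σ) (CharDual σ N) :=
  flip LinearMap.id

theorem eval_injective : Function.Injective (eval σ N) := by
  refine (injective_iff_map_eq_zero _).2 fun n hn => ?_
  exact CharacterModule.eq_zero_of_character_apply fun φ => DFunLike.congr_fun hn φ

end CharDual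

end CharDual

section Flat

namespace BalancedTensor

variable {R : Type u} [Ring R] {N N' M : Type u} [AddCommGroup N] [Module Rᵐᵒᵖ N]
  [AddCommGroup N'] [Module Rᵐᵒᵖ N'] [AddCommGroup M] [Module R M]

/-- The canonical biadditive map into `N ⊗_R M`. -/
def tmul (R : Type u) [Ring R] (N M : Type u) [AddCommGroup N] [Module Rᵐᵒᵖ N] [AddCommGroup M]
    [Module R M] : N →+ M →+ BalancedTensor R N M :=
  AddMonoidHom.mk'
    (fun n => (QuotientAddGroup.mk' _).comp (TensorProduct.mk ℤ N M n).toAddMonoidHom)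
    fun n n' => AddMonoidHom.ext fun m =>
      congrArg (QuotientAddGroup.mk' (balancedRel R N M)) (TensorProduct.add_tmul n n' m)

theorem tmul_smul (n : N) (r : R) (m : M) :
    tmul R N M (MulOpposite.op r • n) m = tmul R N M n (r • m) :=
  QuotientAddGroup.eq_iff_sub_mem.2 (AddSubgroup.subset_closure ⟨n, r, m, rfl⟩)

theorem addMonoidHom_ext {Q : Type*} [AddCommGroup Q] {f g : BalancedTensor R N M →+ Q}
    (h : ∀ n m, f (tmul R N M n m) = g (tmul R N M n m)) : f = g := by
  refine QuotientAddGroup.addMonoidHom_ext _ (AddMonoidHom.ext fun x => ?_)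
  induction x using TensorProduct.induction_on with
  | zero => rw [map_zero, map_zero]
  | tmul n m => exact h n m
  | add x y hx hy => rw [map_add, map_add, hx, hy]

/-- A balanced biadditive map induces an additive map on `N ⊗_R M`. -/
def lift {Q : Type*} [AddCommGroup Q] (B : N →+ M →+ Q)
    (hB : ∀ (n : N) (r : R) (m : M), B (MulOpposite.op r • n) m = B n (r • m)) :
    BalancedTensor R N M →+ Q :=
  QuotientAddGroup.lift _
    (TensorProduct.liftAddHom B fun z n m => by simp) (by
      refine (AddSubgroup.closure_le _).2 ?_
      rintro _ ⟨n, r, m, rfl⟩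
      simp [hB])

/-- Characters of `N ⊗_R M` are homomorphisms from `N` to the character module of `M`. -/
def characterEquiv : (BalancedTensor R N M →+ AddCircle (1 : ℚ)) ≃
    (N →ₗ[Rᵐᵒᵖ] CharDual (RingEquiv.refl Rᵐᵒᵖ) M) where
  toFun c :=
    { toFun := fun n => c.comp (tmul R N M n)
      map_add' := fun n n' => CharDual.ext fun m => by
        change c (tmul R N M (n + n') m) = c (tmul R N M n m) + c (tmul R N M n' m)
        rw [map_add, AddMonoidHom.add_apply, map_add]
      map_smul' := fun r n => CharDual.ext fun m => congrArg c (tmul_smul n r.unop m) }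
  invFun f := lift (AddMonoidHom.mk' (fun n => AddMonoidHomClass.toAddMonoidHom (f n))
    fun n n' => by ext; simp) fun n r m => by simp
  left_inv c := addMonoidHom_ext fun n m => rfl
  right_inv f := rfl

theorem map_injective_iff (f : N →ₗ[Rᵐᵒᵖ] N') : Function.Injective (map R M f) ↔
    Function.Surjective fun h : N' →ₗ[Rᵐᵒᵖ] CharDual (RingEquiv.refl Rᵐᵒᵖ) M => h ∘ₗ f := by
  rw [← Equiv.surjective_comp characterEquiv]
  change _ ↔ Function.Surjective (characterEquiv ∘
    fun c : BalancedTensor R N' M →+ AddCircle (1 : ℚ) => c.comp (map R M f))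
  rw [Equiv.comp_surjective]
  exact (CharacterModule.dual_surjective_iff_injective (f := (map R M f).toIntLinearMap)).symm

end BalancedTensor

variable {R S : Type u} [Ring R] [Ring S] (σ : R ≃+* Sᵐᵒᵖ) {N : Type u} [AddCommGroup N]
  [Module S N]

theorem isFlat_iff_injective_charDual_refl :
    IsFlat S N ↔ Module.Injective Sᵐᵒᵖ (CharDual (RingEquiv.refl Sᵐᵒᵖ) N) := by
  constructor
  · intro h
    refine ⟨fun X Y _ _ _ _ f hf g => ?_⟩
    obtain ⟨h, rfl⟩ := (BalancedTensor.map_injective_iff f).1 (h X Y f hf) g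
    exact ⟨h, fun x => rfl⟩
  · intro h X Y _ _ _ _ f hf
    exact (BalancedTensor.map_injective_iff f).2 fun g => (h.out f hf g).imp fun _ => LinearMap.ext

attribute [local instance] RingHomInvPair.of_ringEquiv in
theorem isFlat_iff_injective_charDual : IsFlat S N ↔ Module.Injective R (CharDual σ N) := by
  rw [isFlat_iff_injective_charDual_refl]
  let e : CharDual σ N ≃ₛₗ[RingHomClass.toRingHom σ] CharDual (RingEquiv.refl Sᵐᵒᵖ) N :=
    { AddEquiv.refl _ with map_smul' := fun _ _ => rfl }
  exact ⟨fun _ => .of_ringEquiv σ.symm e.symm, fun _ => .of_ringEquiv σ e⟩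

end Flat

section ShortExact

variable {R : Type u} [Ring R] {X Y Z X' Y' Z' X'' Y'' Z'' : Type u}
  [AddCommGroup X] [Module R X] [AddCommGroup Y] [Module R Y] [AddCommGroup Z] [Module R Z]
  [AddCommGroup X'] [Module R X'] [AddCommGroup Y'] [Module R Y'] [AddCommGroup Z'] [Module R Z']
  [AddCommGroup X''] [Module R X''] [AddCommGroup Y''] [Module R Y'']
  [AddCommGroup Z''] [Module R Z'']

theorem isShortExact_ker {g : Y →ₗ[R] Z} (hg : Function.Surjective g) :
    IsShortExact (LinearMap.ker g).subtype g :=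
  ⟨Subtype.val_injective, LinearMap.exact_subtype_ker_map g, hg⟩

theorem isShortExact_mkQ {f : X →ₗ[R] Y} (hf : Function.Injective f) :
    IsShortExact f (LinearMap.range f).mkQ :=
  ⟨hf, LinearMap.exact_map_mkQ_range f, Submodule.mkQ_surjective _⟩

theorem isShortExact_inl_snd : IsShortExact (LinearMap.inl R X Y) (LinearMap.snd R X Y) :=
  ⟨LinearMap.inl_injective, Function.Exact.inl_snd, LinearMap.snd_surjective⟩

theorem isShortExact_id_zero :
    IsShortExact (LinearMap.id : X →ₗ[R] X) (0 : X →ₗ[R] PUnit.{u + 1}) :=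
  ⟨Function.injective_id, fun x => ⟨fun _ => ⟨x, rfl⟩, fun _ => rfl⟩, fun _ => ⟨0, rfl⟩⟩

theorem isShortExact_zero_id :
    IsShortExact (0 : PUnit.{u + 1} →ₗ[R] X) (LinearMap.id : X →ₗ[R] X) :=
  ⟨Function.injective_of_subsingleton _,
    fun _ => ⟨fun h => ⟨0, h.symm⟩, fun ⟨_, h⟩ => h.symm⟩, Function.surjective_id⟩

namespace IsShortExact

theorem comp_eq_zero {f : X →ₗ[R] Y} {g : Y →ₗ[R] Z} (h : IsShortExact f g) : g ∘ₗ f = 0 :=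
  h.2.1.linearMap_comp_eq_zero

theorem exists_desc {f : X →ₗ[R] Y} {g : Y →ₗ[R] Z} (h : IsShortExact f g) (ν : Y →ₗ[R] X')
    (hν : ν ∘ₗ f = 0) : ∃ μ : Z →ₗ[R] X', μ ∘ₗ g = ν := by
  have hker : LinearMap.ker g ≤ LinearMap.ker ν := by
    rw [h.2.1.linearMap_ker_eq, LinearMap.range_le_ker_iff, hν]
  refine ⟨(LinearMap.ker g).liftQ ν hker ∘ₗ (g.quotKerEquivOfSurjective h.2.2).symm,
    LinearMap.ext fun y => ?_⟩
  have : (g.quotKerEquivOfSurjective h.2.2).symm (g y) = Submodule.Quotient.mk y :=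
    (LinearEquiv.symm_apply_eq _).2 rfl
  simp [this]

theorem exists_lift {f : X →ₗ[R] Y} {g : Y →ₗ[R] Z} (h : IsShortExact f g) (ν : X' →ₗ[R] Y)
    (hν : g ∘ₗ ν = 0) : ∃ μ : X' →ₗ[R] X, f ∘ₗ μ = ν := by
  have hrange : LinearMap.range ν ≤ LinearMap.range f := by
    rw [← h.2.1.linearMap_ker_eq, LinearMap.range_le_ker_iff, hν]
  refine ⟨(LinearEquiv.ofInjective f h.1).symm ∘ₗ
    ν.codRestrict (LinearMap.range f) fun x => hrange ⟨x, rfl⟩, LinearMap.ext fun x => ?_⟩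
  exact congrArg Subtype.val (LinearEquiv.apply_symm_apply (LinearEquiv.ofInjective f h.1) _)

theorem exists_retraction {f : X →ₗ[R] Y} {g : Y →ₗ[R] Z} (h : IsShortExact f g)
    {s : Z →ₗ[R] Y} (hs : g ∘ₗ s = LinearMap.id) : ∃ r : Y →ₗ[R] X, r ∘ₗ f = LinearMap.id := by
  obtain ⟨r, hr⟩ := h.exists_lift (LinearMap.id - s ∘ₗ g) (by
    rw [LinearMap.comp_sub, ← LinearMap.comp_assoc, hs, LinearMap.comp_id, LinearMap.id_comp,
      sub_self])
  refine ⟨r, LinearMap.ext fun x => h.1 ((DFunLike.congr_fun hr (f x)).trans ?_)⟩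
  simp [h.2.1.apply_apply_eq_zero]

theorem exists_section {f : X →ₗ[R] Y} {g : Y →ₗ[R] Z} (h : IsShortExact f g)
    {r : Y →ₗ[R] X} (hr : r ∘ₗ f = LinearMap.id) : ∃ s : Z →ₗ[R] Y, g ∘ₗ s = LinearMap.id := by
  obtain ⟨s, hs⟩ := h.exists_desc (LinearMap.id - f ∘ₗ r) (by
    rw [LinearMap.sub_comp, LinearMap.comp_assoc, hr, LinearMap.comp_id, LinearMap.id_comp,
      sub_self])
  refine ⟨s, LinearMap.ext fun z => ?_⟩
  obtain ⟨y, rfl⟩ := h.2.2 z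
  refine (congrArg g (DFunLike.congr_fun hs y)).trans ?_
  simp [h.2.1.apply_apply_eq_zero]

theorem exists_retraction_of_injective {f : X →ₗ[R] Y} {g : Y →ₗ[R] Z} (h : IsShortExact f g)
    (hX : Module.Injective R X) : ∃ r : Y →ₗ[R] X, r ∘ₗ f = LinearMap.id :=
  (Module.Baer.of_injective hX).extension_property f h.1 LinearMap.id

theorem nine_coker {f : X →ₗ[R] Y} {g : Y →ₗ[R] Z} {f' : X' →ₗ[R] Y'} {g' : Y' →ₗ[R] Z'}
    {a : X →ₗ[R] X'} {a' : X' →ₗ[R] X''} {b : Y →ₗ[R] Y'} {b' : Y' →ₗ[R] Y''}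
    {c : Z →ₗ[R] Z'} {c' : Z' →ₗ[R] Z''} (h : IsShortExact f g) (h' : IsShortExact f' g')
    (ha : IsShortExact a a') (hb : IsShortExact b b') (hc : IsShortExact c c')
    (hfa : f' ∘ₗ a = b ∘ₗ f) (hgb : g' ∘ₗ b = c ∘ₗ g) :
    ∃ (f'' : X'' →ₗ[R] Y'') (g'' : Y'' →ₗ[R] Z''), IsShortExact f'' g'' := by
  obtain ⟨f'', hf⟩ := ha.exists_desc (b' ∘ₗ f') (by
    rw [LinearMap.comp_assoc, hfa, ← LinearMap.comp_assoc, hb.comp_eq_zero, LinearMap.zero_comp])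
  obtain ⟨g'', hg⟩ := hb.exists_desc (c' ∘ₗ g') (by
    rw [LinearMap.comp_assoc, hgb, ← LinearMap.comp_assoc, hc.comp_eq_zero, LinearMap.zero_comp])
  replace hf := DFunLike.congr_fun hf
  replace hg := DFunLike.congr_fun hg
  replace hfa := DFunLike.congr_fun hfa
  replace hgb := DFunLike.congr_fun hgb
  simp only [LinearMap.comp_apply] at hf hg hfa hgb
  refine ⟨f'', g'', (injective_iff_map_eq_zero _).2 fun x hx => ?_, fun y => ⟨fun hy => ?_, ?_⟩, ?_⟩
  · obtain ⟨x, rfl⟩ := ha.2.2 x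
    obtain ⟨y, hy⟩ := (hb.2.1 (f' x)).1 ((hf x).symm.trans hx)
    obtain ⟨w, rfl⟩ := (h.2.1 y).1 (hc.1 (by
      rw [← hgb, hy, h'.2.1.apply_apply_eq_zero, map_zero]))
    rw [← hfa] at hy
    rw [← h'.1 hy, ha.2.1.apply_apply_eq_zero]
  · obtain ⟨y, rfl⟩ := hb.2.2 y
    obtain ⟨z, hz⟩ := (hc.2.1 (g' y)).1 ((hg y).symm.trans hy)
    obtain ⟨w, rfl⟩ := h.2.2 z
    obtain ⟨x, hx⟩ := (h'.2.1 (y - b w)).1 (by rw [map_sub, hgb, hz, sub_self])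
    exact ⟨a' x, by rw [hf, hx, map_sub, hb.2.1.apply_apply_eq_zero, sub_zero]⟩
  · rintro ⟨x, rfl⟩
    obtain ⟨x, rfl⟩ := ha.2.2 x
    rw [hf, hg, h'.2.1.apply_apply_eq_zero, map_zero]
  · intro z
    obtain ⟨z, rfl⟩ := hc.2.2 z
    obtain ⟨y, rfl⟩ := h'.2.2 z
    exact ⟨b' y, hg y⟩

theorem nine_ker {f' : X' →ₗ[R] Y'} {g' : Y' →ₗ[R] Z'} {f'' : X'' →ₗ[R] Y''} {g'' : Y'' →ₗ[R] Z''}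
    {a : X →ₗ[R] X'} {a' : X' →ₗ[R] X''} {b : Y →ₗ[R] Y'} {b' : Y' →ₗ[R] Y''}
    {c : Z →ₗ[R] Z'} {c' : Z' →ₗ[R] Z''} (h' : IsShortExact f' g') (h'' : IsShortExact f'' g'')
    (ha : IsShortExact a a') (hb : IsShortExact b b') (hc : IsShortExact c c')
    (hfa : f'' ∘ₗ a' = b' ∘ₗ f') (hgb : g'' ∘ₗ b' = c' ∘ₗ g') :
    ∃ (f : X →ₗ[R] Y) (g : Y →ₗ[R] Z), IsShortExact f g := by
  obtain ⟨f, hf⟩ := hb.exists_lift (f' ∘ₗ a) (by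
    rw [← LinearMap.comp_assoc, ← hfa, LinearMap.comp_assoc, ha.comp_eq_zero, LinearMap.comp_zero])
  obtain ⟨g, hg⟩ := hc.exists_lift (g' ∘ₗ b) (by
    rw [← LinearMap.comp_assoc, ← hgb, LinearMap.comp_assoc, hb.comp_eq_zero, LinearMap.comp_zero])
  replace hf := DFunLike.congr_fun hf
  replace hg := DFunLike.congr_fun hg
  replace hfa := DFunLike.congr_fun hfa
  replace hgb := DFunLike.congr_fun hgb
  simp only [LinearMap.comp_apply] at hf hg hfa hgb
  refine ⟨f, g, (injective_iff_map_eq_zero _).2 fun x hx => ?_, fun y => ⟨fun hy => ?_, ?_⟩, ?_⟩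
  · exact ha.1 (h'.1 (by rw [← hf, hx, map_zero, map_zero, map_zero]))
  · obtain ⟨x, hx⟩ := (h'.2.1 (b y)).1 (by rw [← hg, hy, map_zero])
    obtain ⟨x, rfl⟩ := (ha.2.1 x).1 (h''.1 (by
      rw [hfa, hx, hb.2.1.apply_apply_eq_zero, map_zero]))
    exact ⟨x, hb.1 (by rw [hf, hx])⟩
  · rintro ⟨x, rfl⟩
    exact hc.1 (by rw [hg, hf, h'.2.1.apply_apply_eq_zero, map_zero])
  · intro z
    obtain ⟨y, hy⟩ := h'.2.2 (c z)
    obtain ⟨w, hw⟩ := (h''.2.1 (b' y)).1 (by rw [hgb, hy, hc.2.1.apply_apply_eq_zero])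
    obtain ⟨x, rfl⟩ := ha.2.2 w
    obtain ⟨v, hv⟩ := (hb.2.1 (y - f' x)).1 (by rw [map_sub, ← hfa, hw, sub_self])
    exact ⟨v, hc.1 (by rw [hg, hv, map_sub, h'.2.1.apply_apply_eq_zero, sub_zero, hy])⟩

theorem exists_ker_comp {f : X →ₗ[R] Y} {g : Y →ₗ[R] Z} {i : X' →ₗ[R] Z} {p : Z →ₗ[R] Y'}
    (h : IsShortExact f g) (h' : IsShortExact i p) :
    ∃ (a : X →ₗ[R] LinearMap.ker (p ∘ₗ g)) (b : LinearMap.ker (p ∘ₗ g) →ₗ[R] X'),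
      IsShortExact a b :=
  nine_ker h isShortExact_zero_id isShortExact_id_zero (isShortExact_ker (h'.2.2.comp h.2.2)) h'
    (LinearMap.ext fun x => by simp [h.2.1.apply_apply_eq_zero]) rfl

theorem horseshoe {f'' : X'' →ₗ[R] Y''} {g'' : Y'' →ₗ[R] Z''} {a : X →ₗ[R] X'}
    {a' : X' →ₗ[R] X''} {c : Z →ₗ[R] Z'} {c' : Z' →ₗ[R] Z''} (h'' : IsShortExact f'' g'')
    (ha : IsShortExact a a') (hc : IsShortExact c c') {ψ : Z' →ₗ[R] Y''} (hψ : g'' ∘ₗ ψ = c') :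
    ∃ (K : ModuleCat.{u} R) (b : K →ₗ[R] X' × Z') (b' : X' × Z' →ₗ[R] Y'') (f : X →ₗ[R] K)
      (g : K →ₗ[R] Z), IsShortExact b b' ∧ IsShortExact f g := by
  let b' : X' × Z' →ₗ[R] Y'' := (f'' ∘ₗ a').coprod ψ
  have hb' : Function.Surjective b' := fun y => by
    obtain ⟨z, hz⟩ := hc.2.2 (g'' y)
    obtain ⟨x, hx⟩ := (h''.2.1 (y - ψ z)).1 (by
      rw [map_sub, ← hz, ← hψ, LinearMap.comp_apply, sub_self])
    obtain ⟨x, rfl⟩ := ha.2.2 x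
    exact ⟨(x, z), by simp [b', hx]⟩
  obtain ⟨f, g, h⟩ := nine_ker isShortExact_inl_snd h'' ha (isShortExact_ker hb') hc
    (LinearMap.ext fun x => by simp [b'])
    (LinearMap.ext fun x => by simp [b', ← hψ, h''.2.1.apply_apply_eq_zero])
  exact ⟨.of R (LinearMap.ker b'), _, b', f, g, isShortExact_ker hb', h⟩

theorem finsupp {f : X →ₗ[R] Y} {g : Y →ₗ[R] Z} (h : IsShortExact f g) (ι : Type u) :
    IsShortExact (Finsupp.mapRange.linearMap (α := ι) f) (Finsupp.mapRange.linearMap g) := by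
  refine ⟨Finsupp.mapRange_injective _ (map_zero f) h.1, fun b => ⟨fun hb => ?_, ?_⟩,
    Finsupp.mapRange_surjective _ (map_zero g) h.2.2⟩
  · choose a ha using fun x => (h.2.1 (b x)).1 (DFunLike.congr_fun hb x)
    refine ⟨Finsupp.onFinset b.support a fun x hx => ?_, Finsupp.ext fun x => by simp [ha]⟩
    rw [Finsupp.mem_support_iff, ← ha]
    exact fun h0 => hx (h.1 (h0.trans (map_zero f).symm))
  · rintro ⟨a, rfl⟩
    ext x
    simp [h.2.1.apply_apply_eq_zero]

end IsShortExact

/-- The fibre product `X ×_Z Y` of two homomorphisms into `Z`. -/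
abbrev FiberProduct (f : X →ₗ[R] Z) (g : Y →ₗ[R] Z) : Submodule R (X × Y) :=
  LinearMap.eqLocus (f ∘ₗ LinearMap.fst R X Y) (g ∘ₗ LinearMap.snd R X Y)

namespace FiberProduct

variable (f : X →ₗ[R] Z) (g : Y →ₗ[R] Z)

/-- The projection `X ×_Z Y → X`. -/
abbrev fst : FiberProduct f g →ₗ[R] X := LinearMap.fst R X Y ∘ₗ Submodule.subtype _

/-- The projection `X ×_Z Y → Y`. -/
abbrev snd : FiberProduct f g →ₗ[R] Y := LinearMap.snd R X Y ∘ₗ Submodule.subtype _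

variable {f g} in
/-- The homomorphism into the fibre product with the given components. -/
def lift (a : X' →ₗ[R] X) (b : X' →ₗ[R] Y) (h : f ∘ₗ a = g ∘ₗ b) : X' →ₗ[R] FiberProduct f g :=
  (a.prod b).codRestrict _ (DFunLike.congr_fun h)

theorem isShortExact_fst {i : X' →ₗ[R] Y} {g : Y →ₗ[R] Z} (h : IsShortExact i g) :
    IsShortExact (lift 0 i (by rw [h.comp_eq_zero, LinearMap.comp_zero])) (fst f g) := by
  refine ⟨fun x y hxy => h.1 (congrArg (fun p => p.1.2) hxy), ?_, fun x => ?_⟩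
  · rintro ⟨⟨x, y⟩, hxy : f x = g y⟩
    constructor
    · rintro (rfl : x = 0)
      obtain ⟨w, rfl⟩ := (h.2.1 y).1 (by rw [← hxy, map_zero])
      exact ⟨w, rfl⟩
    · rintro ⟨w, hw⟩
      exact (congrArg (fun p => p.1.1) hw).symm
  · obtain ⟨y, hy⟩ := h.2.2 (f x)
    exact ⟨⟨(x, y), hy.symm⟩, rfl⟩

theorem isShortExact_snd {i : X' →ₗ[R] X} {f : X →ₗ[R] Z} (h : IsShortExact i f) :
    IsShortExact (lift i 0 (by rw [h.comp_eq_zero, LinearMap.comp_zero])) (snd f g) := by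
  refine ⟨fun x y hxy => h.1 (congrArg (fun p => p.1.1) hxy), ?_, fun y => ?_⟩
  · rintro ⟨⟨x, y⟩, hxy : f x = g y⟩
    constructor
    · rintro (rfl : y = 0)
      obtain ⟨w, rfl⟩ := (h.2.1 x).1 (by rw [hxy, map_zero])
      exact ⟨w, rfl⟩
    · rintro ⟨w, hw⟩
      exact (congrArg (fun p => p.1.2) hw).symm
  · obtain ⟨x, hx⟩ := h.2.2 (g y)
    exact ⟨⟨(x, y), hx⟩, rfl⟩

end FiberProduct

end ShortExact

section InjectiveDimension

variable {R : Type u} [Ring R]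

/-- `M` has injective dimension at most `d`. -/
abbrev IdLE (R : Type u) [Ring R] (d : ℕ) (M : Type u) [AddCommGroup M] [Module R M] : Prop :=
  HasInjectiveDimensionLE (ModuleCat.of R M) d

variable {X Y Z : Type u} [AddCommGroup X] [Module R X] [AddCommGroup Y] [Module R Y]
  [AddCommGroup Z] [Module R Z] {d e : ℕ}

theorem exists_injective_embedding (R : Type u) [Ring R] (X : Type u) [AddCommGroup X]
    [Module R X] : ∃ (E : ModuleCat.{u} R) (f : X →ₗ[R] E),
      Module.Injective R E ∧ Function.Injective f := by
  obtain ⟨I, _, f, _⟩ := EnoughInjectives.presentation (ModuleCat.of R X)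
  exact ⟨I, f.hom, Module.injective_module_of_injective_object R I,
    (ModuleCat.mono_iff_injective f).1 inferInstance⟩

theorem idLE_zero_iff : IdLE R 0 X ↔ Module.Injective R X := by
  rw [IdLE, HasInjectiveDimensionLE, zero_add, ← injective_iff_hasInjectiveDimensionLT_one,
    ← Module.injective_iff_injective_object]

theorem IdLE.mono (h : IdLE R d X) (hde : d ≤ e) : IdLE R e X :=
  hasInjectiveDimensionLT_of_ge _ (d + 1) _ (by lia)

theorem idLE_of_injective (h : Module.Injective R X) : IdLE R d X :=
  (idLE_zero_iff.2 h).mono d.zero_le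

theorem IdLE.of_retract (h : IdLE R d Y) (i : X →ₗ[R] Y) (r : Y →ₗ[R] X)
    (hri : r ∘ₗ i = LinearMap.id) : IdLE R d X :=
  Retract.hasInjectiveDimensionLT (X := ModuleCat.of R X) (Y := ModuleCat.of R Y)
    ⟨ModuleCat.ofHom i, ModuleCat.ofHom r, by rw [← ModuleCat.ofHom_comp, hri]; rfl⟩ _

namespace IsShortExact

variable {f : X →ₗ[R] Y} {g : Y →ₗ[R] Z} (h : IsShortExact f g)
include h

theorem shortExact :
    (ModuleCat.shortComplexOfCompEqZero f g h.comp_eq_zero).ShortExact :=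
  ModuleCat.shortComplex_shortExact _ h.2.1 h.1 h.2.2

theorem idLE_left (hY : IdLE R (d + 1) Y) (hZ : IdLE R d Z) : IdLE R (d + 1) X :=
  h.shortExact.hasInjectiveDimensionLT_X₁ _ hZ hY

theorem idLE_middle (hX : IdLE R d X) (hZ : IdLE R d Z) : IdLE R d Y :=
  h.shortExact.hasInjectiveDimensionLT_X₂ _ hX hZ

theorem idLE_right (hX : IdLE R (d + 1) X) (hY : IdLE R d Y) : IdLE R d Z :=
  h.shortExact.hasInjectiveDimensionLT_X₃ _ hY hX

end IsShortExact

end InjectiveDimension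

section FlatDimension

variable {R S : Type u} [Ring R] [Ring S] (σ : R ≃+* Sᵐᵒᵖ) {X Y Z : Type u} [AddCommGroup X]
  [Module S X] [AddCommGroup Y] [Module S Y] [AddCommGroup Z] [Module S Z] {d e : ℕ}

theorem isFlat_of_projective [Module.Projective S X] : IsFlat S X := by
  refine (isFlat_iff_injective_charDual (RingEquiv.refl Sᵐᵒᵖ)).2 ⟨fun A B _ _ _ _ f hf g => ?_⟩
  obtain ⟨h, hh⟩ := Module.projective_lifting_property (CharDual.map (swapOp _) f)
    (CharDual.flip g) (CharDual.map_surjective hf)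
  exact ⟨CharDual.flip h,
    fun a => CharDual.ext fun x => DFunLike.congr_fun (DFunLike.congr_fun hh x) a⟩

theorem IsFlat.finsupp (h : IsFlat S X) (ι : Type u) : IsFlat S (ι →₀ X) := by
  let σ := RingEquiv.refl Sᵐᵒᵖ
  rw [isFlat_iff_injective_charDual σ] at h ⊢
  let i : CharDual σ (ι →₀ X) →ₗ[Sᵐᵒᵖ] (ι → CharDual σ X) :=
    LinearMap.pi fun a => CharDual.map σ (Finsupp.lsingle a)
  let t : (ι →₀ X) →ₗ[S] CharDual (swapOp σ) (ι → CharDual σ X) :=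
    Finsupp.lsum ℕ fun a => CharDual.flip (LinearMap.proj a)
  have ht (a : ι) (x : X) : t (Finsupp.single a x) = CharDual.flip (LinearMap.proj a) x :=
    Finsupp.lsum_single ..
  refine idLE_zero_iff.1
    ((idLE_of_injective (Module.Injective.pi _ _)).of_retract i (CharDual.flip t) ?_)
  ext φ x
  induction x using Finsupp.induction_linear with
  | zero => simp only [map_zero]
  | add x y hx hy => rw [map_add, map_add, hx, hy]
  | single a x => exact DFunLike.congr_fun (ht a x) (i φ)

theorem exists_isFlat_surjective (S : Type u) [Ring S] (X : Type u) [AddCommGroup X]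
    [Module S X] : ∃ p : (X →₀ S) →ₗ[S] X, IsFlat S (X →₀ S) ∧ Function.Surjective p :=
  ⟨Finsupp.linearCombination S id, isFlat_of_projective,
    Finsupp.linearCombination_id_surjective S X⟩

theorem flatDimLE_iff_idLE_charDual : FlatDimLE S d X ↔ IdLE R d (CharDual σ X) := by
  induction d generalizing X with
  | zero => exact (isFlat_iff_injective_charDual σ).trans idLE_zero_iff.symm
  | succ d ih =>
    constructor
    · rintro ⟨F, p, hF, hp, hK⟩
      exact (CharDual.isShortExact_map (isShortExact_ker hp)).idLE_left
        (idLE_of_injective ((isFlat_iff_injective_charDual σ).1 hF)) (ih.1 hK)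
    · intro h
      obtain ⟨p, hF, hp⟩ := exists_isFlat_surjective S X
      exact ⟨.of S (X →₀ S), p, hF, hp, ih.2 <|
        (CharDual.isShortExact_map (isShortExact_ker hp)).idLE_right h
          (idLE_of_injective ((isFlat_iff_injective_charDual σ).1 hF))⟩

theorem FlatDimLE.mono (h : FlatDimLE S d X) (hde : d ≤ e) : FlatDimLE S e X := by
  rw [flatDimLE_iff_idLE_charDual (RingEquiv.refl Sᵐᵒᵖ)] at h ⊢
  exact IdLE.mono h hde

theorem FlatDimLE.of_retract (h : FlatDimLE S d Y) (i : X →ₗ[S] Y) (r : Y →ₗ[S] X)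
    (hri : r ∘ₗ i = LinearMap.id) : FlatDimLE S d X := by
  rw [flatDimLE_iff_idLE_charDual (RingEquiv.refl Sᵐᵒᵖ)] at h ⊢
  exact IdLE.of_retract h (CharDual.map _ r) (CharDual.map _ i)
    (by rw [← CharDual.map_comp, hri, CharDual.map_id])

theorem FlatDimLE.finsupp (h : FlatDimLE S d X) (ι : Type u) : FlatDimLE S d (ι →₀ X) := by
  induction d generalizing X with
  | zero => exact IsFlat.finsupp h ι
  | succ d ih =>
    obtain ⟨F, p, hF, hp, hK⟩ := h
    have hs := CharDual.isShortExact_map (σ := RingEquiv.refl Sᵐᵒᵖ)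
      ((isShortExact_ker hp).finsupp ι)
    exact (flatDimLE_iff_idLE_charDual _).2 (hs.idLE_left
      (idLE_of_injective ((isFlat_iff_injective_charDual _).1 (hF.finsupp ι)))
      ((flatDimLE_iff_idLE_charDual _).1 (ih hK)))

namespace IsShortExact

variable {f : X →ₗ[S] Y} {g : Y →ₗ[S] Z} (h : IsShortExact f g)
include h

theorem flatDimLE_middle (hX : FlatDimLE S d X) (hZ : FlatDimLE S d Z) : FlatDimLE S d Y := by
  rw [flatDimLE_iff_idLE_charDual (RingEquiv.refl Sᵐᵒᵖ)] at hX hZ ⊢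
  exact (CharDual.isShortExact_map h).idLE_middle hZ hX

end IsShortExact

end FlatDimension

section Noetherian

variable {R S : Type u} [Ring R] [Ring S] {N : Type u} [AddCommGroup N] [Module S N] {d : ℕ}

theorem exists_smul_eq_of_injective (hN : Module.Injective S N) {ι : Type*} [Fintype ι] (a : ι → S)
    (y : ι → N) (h : ∀ c : ι → S, ∑ i, c i • a i = 0 → ∑ i, c i • y i = 0) :
    ∃ x : N, ∀ i, a i • x = y i := by
  classical
  obtain ⟨μ, hμ⟩ := exists_comp_eq_of_baer (.of_injective hN) (Fintype.linearCombination S a)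
    (Fintype.linearCombination S y) h
  refine ⟨μ 1, fun i => ?_⟩
  simpa [← map_smul] using DFunLike.congr_fun hμ (Pi.single i 1)

theorem injective_of_exists_smul_eq [IsNoetherianRing S]
    (h : ∀ (n : ℕ) (a : Fin n → S) (y : Fin n → N),
      (∀ c : Fin n → S, ∑ i, c i • a i = 0 → ∑ i, c i • y i = 0) →
        ∃ x : N, ∀ i, a i • x = y i) :
    Module.Injective S N := by
  refine Module.Baer.injective fun I g => ?_
  obtain ⟨n, a, ha⟩ := Submodule.fg_iff_exists_fin_generating_family.1
    (IsNoetherian.noetherian (⊤ : Submodule S I))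
  obtain ⟨x, hx⟩ := h n (fun i => a i) (fun i => g (a i)) fun c hc => by
    have : ∑ i, c i • a i = 0 := Subtype.ext (by simpa using hc)
    simpa using congrArg g this
  have heq : LinearMap.toSpanSingleton S N x ∘ₗ I.subtype = g :=
    LinearMap.ext_on_range ha hx
  exact ⟨LinearMap.toSpanSingleton S N x, fun b hb => DFunLike.congr_fun heq ⟨b, hb⟩⟩

theorem injective_finsupp [IsNoetherianRing S] (hN : Module.Injective S N) (ι : Type u) :
    Module.Injective S (ι →₀ N) := by
  classical
  refine injective_of_exists_smul_eq fun n a y h => ?_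
  have hx (t : ι) : ∃ x : N, (∀ i, a i • x = y i t) ∧ ((∀ i, y i t = 0) → x = 0) := by
    by_cases ht : ∀ i, y i t = 0
    · exact ⟨0, fun i => by rw [smul_zero, ht], fun _ => rfl⟩
    · obtain ⟨x, hx⟩ := exists_smul_eq_of_injective hN a (fun i => y i t) fun c hc => by
        simpa [Finsupp.finsetSum_apply] using DFunLike.congr_fun (h c hc) t
      exact ⟨x, hx, fun h => absurd h ht⟩
  choose x hx hx0 using hx
  refine ⟨Finsupp.onFinset (Finset.univ.biUnion fun i => (y i).support) x fun t ht => ?_,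
    fun i => Finsupp.ext fun t => hx t i⟩
  obtain ⟨i, hi⟩ := not_forall.1 (mt (hx0 t) ht)
  exact Finset.mem_biUnion.2 ⟨i, Finset.mem_univ i, Finsupp.mem_support_iff.2 hi⟩

theorem exists_relations_generators [IsNoetherianRing S] {n : ℕ} (a : Fin n → S) :
    ∃ (m : ℕ) (s : Fin m → Fin n → S), (∀ j, ∑ i, s j i • a i = 0) ∧
      ∀ y : Fin n → N, (∀ j, ∑ i, s j i • y i = 0) →
        ∀ c : Fin n → S, ∑ i, c i • a i = 0 → ∑ i, c i • y i = 0 := by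
  obtain ⟨m, s, hs⟩ := Submodule.fg_iff_exists_fin_generating_family.1
    (IsNoetherian.noetherian (LinearMap.ker (Fintype.linearCombination S a)))
  refine ⟨m, s, fun j => hs.le (Submodule.subset_span ⟨j, rfl⟩), fun y hy c hc => ?_⟩
  have : LinearMap.ker (Fintype.linearCombination S a) ≤
      LinearMap.ker (Fintype.linearCombination S y) := by
    rw [← hs, Submodule.span_le]
    rintro _ ⟨j, rfl⟩
    exact hy j
  exact this hc

/-- For `N` injective, a character of `N ^ n` that vanishes on the tuples `(a i • x) i` factors
through the map `N ^ n → N ^ m` given by the relations of `a`. -/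
theorem sum_apply_comp_single_eq_zero [IsNoetherianRing S] (hN : Module.Injective S N)
    (σ : R ≃+* Sᵐᵒᵖ) {n : ℕ} (a : Fin n → S) (y : Fin n → CharDual (swapOp σ) (CharDual σ N))
    (h : ∀ c : Fin n → S, ∑ i, c i • a i = 0 → ∑ i, c i • y i = 0)
    (φ : (Fin n → N) →+ AddCircle (1 : ℚ)) (hφ : ∀ x : N, φ (fun i => a i • x) = 0) :
    ∑ i, y i (φ.comp (AddMonoidHom.single (fun _ => N) i)) = 0 := by
  obtain ⟨m, s, hsa, hs⟩ := exists_relations_generators (N := N) a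
  let ρ : (Fin n → N) →+ (Fin m → N) := AddMonoidHom.mk' (fun z j => ∑ i, s j i • z i)
    fun z w => funext fun j => by simp [Finset.sum_add_distrib]
  obtain ⟨ψ, hψ⟩ := exists_addMonoidHom_comp_eq ρ φ fun z hz => by
    obtain ⟨x, hx⟩ := exists_smul_eq_of_injective hN a z (hs z (congrFun hz))
    exact (congrArg φ (funext hx)).symm.trans (hφ x)
  let ψ' (j : Fin m) : CharDual σ N := ψ.comp (AddMonoidHom.single (fun _ => N) j)
  have hsingle (i : Fin n) : φ.comp (AddMonoidHom.single (fun _ => N) i) =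
      ∑ j, (swapOp σ (s j i)).unop • ψ' j := by
    refine CharDual.ext fun x => ?_
    rw [CharDual.sum_apply]
    simp only [CharDual.unop_swapOp_smul_apply]
    change φ (Pi.single i x) = ∑ j, ψ (Pi.single j (s j i • x))
    rw [← hψ, ← map_sum, Finset.univ_sum_single]
    exact congrArg ψ (funext fun j => by simp [ρ, Pi.single_apply])
  calc ∑ i, y i (φ.comp (AddMonoidHom.single (fun _ => N) i))
      = ∑ i, ∑ j, (s j i • y i) (ψ' j) := by
        simp only [hsingle, map_sum]
        rfl
    _ = ∑ j, (∑ i, s j i • y i) (ψ' j) := by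
        rw [Finset.sum_comm]
        simp only [CharDual.sum_apply]
    _ = 0 := Finset.sum_eq_zero fun j _ => by rw [h (s j) (hsa j), CharDual.zero_apply]

theorem injective_doubleDual [IsNoetherianRing S] (hN : Module.Injective S N) (σ : R ≃+* Sᵐᵒᵖ) :
    Module.Injective S (CharDual (swapOp σ) (CharDual σ N)) := by
  refine injective_of_exists_smul_eq fun n a y h => ?_
  let ν : N →+ (Fin n → N) := AddMonoidHom.mk' (fun x i => a i • x)
    fun x x' => funext fun i => smul_add _ _ _
  let G : ((Fin n → N) →+ AddCircle (1 : ℚ)) →+ AddCircle (1 : ℚ) := AddMonoidHom.mk'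
    (fun φ => ∑ i, y i (φ.comp (AddMonoidHom.single (fun _ => N) i))) fun φ φ' => by
      simp only [AddMonoidHom.add_comp, ← Finset.sum_add_distrib]
      exact Finset.sum_congr rfl fun i _ => map_add (y i) _ _
  obtain ⟨χ, hχ⟩ := exists_addMonoidHom_comp_eq (AddMonoidHom.compHom' ν) G fun φ hφ =>
    sum_apply_comp_single_eq_zero hN σ a y h φ (DFunLike.congr_fun hφ)
  let χ' : CharDual (swapOp σ) (CharDual σ N) := χ
  refine ⟨χ', fun i => CharDual.ext fun φ => ?_⟩
  let φi : (Fin n → N) →+ AddCircle (1 : ℚ) := AddMonoidHom.comp φ (Pi.evalAddMonoidHom _ i)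
  have hφi : (swapOp σ (a i)).unop • φ = φi.comp ν :=
    CharDual.ext (CharDual.unop_swapOp_smul_apply (a i) φ)
  calc (a i • χ') φ = G φi := (congrArg χ hφi).trans (hχ φi)
    _ = y i (φi.comp (AddMonoidHom.single (fun _ => N) i)) := by
        refine Finset.sum_eq_single i (fun k _ hk => ?_)
          fun hi => absurd (Finset.mem_univ i) hi
        refine (congrArg (y k) (CharDual.ext fun x => ?_)).trans (map_zero (y k))
        exact (congrArg φ (Pi.single_eq_of_ne (M := fun _ => N) hk.symm x)).trans (map_zero φ)
    _ = y i φ := congrArg (y i) <| CharDual.ext fun x =>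
        congrArg φ (Pi.single_eq_same (M := fun _ => N) i x)

theorem IdLE.doubleDual [IsNoetherianRing S] (h : IdLE S d N) (σ : R ≃+* Sᵐᵒᵖ) :
    IdLE S d (CharDual (swapOp σ) (CharDual σ N)) := by
  induction d generalizing N with
  | zero => exact idLE_zero_iff.2 (injective_doubleDual (idLE_zero_iff.1 h) σ)
  | succ d ih =>
    obtain ⟨E, f, hE, hf⟩ := exists_injective_embedding S N
    have hs := isShortExact_mkQ hf
    have hs' := CharDual.isShortExact_map (σ := swapOp σ) (CharDual.isShortExact_map (σ := σ) hs)
    exact hs'.idLE_left (idLE_of_injective (injective_doubleDual hE σ))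
      (ih (hs.idLE_right h (idLE_of_injective hE)))

theorem IdLE.flatDimLE_charDual [IsNoetherianRing S] (h : IdLE S d N) (σ : R ≃+* Sᵐᵒᵖ) :
    FlatDimLE R d (CharDual σ N) :=
  (flatDimLE_iff_idLE_charDual (swapOp σ)).2 (h.doubleDual σ)

end Noetherian

section HasG

variable {R S : Type u} [Ring R] [Ring S] {X Y Z : Type u} [AddCommGroup X] [Module S X]
  [AddCommGroup Y] [Module S Y] [AddCommGroup Z] [Module S Z] {n n' k k' : ℕ}

/-- `X` has an injective coresolution, not necessarily minimal, whose `i`-th term has flat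
dimension at most `k + i` for `i < n`. This is the `G_n(k)` condition in a form that is visibly
inherited by extensions and direct sums; it is shown to be equivalent to `IsG` below. -/
def HasG (S : Type u) [Ring S] : ℕ → ℕ → ∀ (X : Type u) [AddCommGroup X] [Module S X], Prop
  | 0, _, _, _, _ => True
  | n + 1, k, X, _, _ => ∃ (E X' : ModuleCat.{u} S) (f : X →ₗ[S] E) (g : E →ₗ[S] X'),
      Module.Injective S E ∧ FlatDimLE S k E ∧ IsShortExact f g ∧ HasG S n (k + 1) X'

namespace HasG

theorem mono (h : HasG S n k X) (hn : n' ≤ n) (hk : k ≤ k') : HasG S n' k' X := by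
  induction n' generalizing n k k' X with
  | zero => trivial
  | succ n' ih =>
    obtain _ | n := n
    · exact absurd hn (by lia)
    obtain ⟨E, X', f, g, hE, hfd, hs, hX'⟩ := h
    exact ⟨E, X', f, g, hE, hfd.mono hk, hs, ih hX' (by lia) (by lia)⟩

theorem finsupp [IsNoetherianRing S] (h : HasG S n k X) (ι : Type u) : HasG S n k (ι →₀ X) := by
  induction n generalizing k X with
  | zero => trivial
  | succ n ih =>
    obtain ⟨E, X', f, g, hE, hfd, hs, hX'⟩ := h
    exact ⟨.of S (ι →₀ E), .of S (ι →₀ X'), _, _, injective_finsupp hE ι, hfd.finsupp ι,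
      hs.finsupp ι, ih hX'⟩

theorem doubleDual [IsNoetherianRing R] [IsNoetherianRing S] (h : HasG S n k X)
    (σ : R ≃+* Sᵐᵒᵖ) : HasG S n k (CharDual (swapOp σ) (CharDual σ X)) := by
  induction n generalizing k X with
  | zero => trivial
  | succ n ih =>
    obtain ⟨E, X', f, g, hE, hfd, hs, hX'⟩ := h
    exact ⟨.of S (CharDual (swapOp σ) (CharDual σ E)), .of S (CharDual (swapOp σ) (CharDual σ X')),
      _, _, injective_doubleDual hE σ,
      ((flatDimLE_iff_idLE_charDual σ).1 hfd).flatDimLE_charDual (swapOp σ),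
      CharDual.isShortExact_map (CharDual.isShortExact_map hs), ih hX'⟩

end HasG

namespace IsShortExact

variable {f : X →ₗ[S] Y} {g : Y →ₗ[S] Z} (h : IsShortExact f g)
include h

theorem hasG_middle (hX : HasG S n k X) (hZ : HasG S n k Z) : HasG S n k Y := by
  induction n generalizing k X Y Z with
  | zero => trivial
  | succ n ih =>
    obtain ⟨A, X', a, a', hA, hAk, ha, hX'⟩ := hX
    obtain ⟨C, Z', c, c', hC, hCk, hc, hZ'⟩ := hZ
    obtain ⟨e, he⟩ := (Module.Baer.of_injective hA).extension_property f h.1 a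
    let b : Y →ₗ[S] A × C := e.prod (c ∘ₗ g)
    have hb : Function.Injective b := (injective_iff_map_eq_zero _).2 fun y hy => by
      obtain ⟨x, rfl⟩ := (h.2.1 y).1 (hc.1 ((congrArg Prod.snd hy).trans (map_zero c).symm))
      have hx : a x = 0 := (DFunLike.congr_fun he x).symm.trans (congrArg Prod.fst hy)
      rw [ha.1 (hx.trans (map_zero a).symm), map_zero]
    have hAC := isShortExact_inl_snd (R := S) (X := A) (Y := C)
    obtain ⟨f'', g'', h''⟩ := nine_coker h hAC ha (isShortExact_mkQ hb) hc
      (LinearMap.ext fun x => Prod.ext (DFunLike.congr_fun he x).symm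
        (by simp [b, h.2.1.apply_apply_eq_zero])) rfl
    exact ⟨.of S (A × C), .of S ((A × C) ⧸ LinearMap.range b), b, _,
      idLE_zero_iff.1 (hAC.idLE_middle (idLE_zero_iff.2 hA) (idLE_zero_iff.2 hC)),
      hAC.flatDimLE_middle hAk hCk, isShortExact_mkQ hb, ih h'' hX' hZ'⟩

theorem hasG_left (hY : HasG S (n + 1) k Y) (hZ : HasG S n (k + 1) Z) : HasG S (n + 1) k X := by
  obtain ⟨E, Y', a, a', hE, hEk, ha, hY'⟩ := hY
  have hq := isShortExact_mkQ (f := a ∘ₗ f) (ha.1.comp h.1)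
  obtain ⟨f'', g'', h''⟩ := nine_coker isShortExact_id_zero ha h hq isShortExact_zero_id rfl
    (LinearMap.ext fun x => ha.2.1.apply_apply_eq_zero (f x))
  exact ⟨E, .of S (E ⧸ LinearMap.range (a ∘ₗ f)), a ∘ₗ f, _, hE, hEk, hq,
    h''.hasG_middle hZ hY'⟩

end IsShortExact

theorem hasG_of_forall_exists_isShortExact {P : ModuleCat.{u} S → Prop}
    (hP : ∀ V, P V → ∃ (U W : ModuleCat.{u} S) (f : V →ₗ[S] U) (g : U →ₗ[S] W),
      IsShortExact f g ∧ HasG S n k U ∧ P W) (V : ModuleCat.{u} S) (hV : P V) :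
    HasG S n k V := by
  suffices H : ∀ m j, m ≤ n → k ≤ j → ∀ V, P V → HasG S m j V from H n k le_rfl le_rfl V hV
  intro m
  induction m with
  | zero => intros; trivial
  | succ m ih =>
    intro j hm hj V hV
    obtain ⟨U, W, f, g, hs, hU, hW⟩ := hP V hV
    exact hs.hasG_left (hU.mono hm hj) (ih (j + 1) (by lia) (by lia) W hW)

theorem HasG.of_retract (h : HasG S n k Y) (i : X →ₗ[S] Y) (r : Y →ₗ[S] X)
    (hri : r ∘ₗ i = LinearMap.id) : HasG S n k X := by
  refine hasG_of_forall_exists_isShortExact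
    (P := fun V => ∃ (i : V →ₗ[S] Y) (r : Y →ₗ[S] V), r ∘ₗ i = LinearMap.id) ?_ (.of S X)
    ⟨i, r, hri⟩
  rintro V ⟨i, r, hri⟩
  have hri' := DFunLike.congr_fun hri
  have hi : Function.Injective i := Function.LeftInverse.injective hri'
  have hs := isShortExact_mkQ hi
  obtain ⟨t, ht⟩ := hs.exists_section hri
  exact ⟨.of S Y, .of S (Y ⧸ LinearMap.range i), i, _, hs, h, t, _, ht⟩

/-- If `F → V` is surjective with `F` free and `V` flat, then `F* ← V*` has a retraction `r`, and
`r* : V** → F**` restricts to an embedding of `V` with flat cokernel. -/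
theorem exists_isShortExact_doubleDual_of_isFlat [IsNoetherianRing R] (σ : R ≃+* Sᵐᵒᵖ)
    (hX : IsFlat S X) : ∃ (W : ModuleCat.{u} S)
      (f : X →ₗ[S] CharDual (swapOp σ) (CharDual σ (X →₀ S)))
      (g : CharDual (swapOp σ) (CharDual σ (X →₀ S)) →ₗ[S] W), IsShortExact f g ∧ IsFlat S W := by
  obtain ⟨p, hF, hp⟩ := exists_isFlat_surjective S X
  rw [isFlat_iff_injective_charDual σ] at hX hF
  obtain ⟨r, hr⟩ := (CharDual.isShortExact_map (σ := σ)
    (isShortExact_ker hp)).exists_retraction_of_injective hX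
  let f : X →ₗ[S] CharDual (swapOp σ) (CharDual σ (X →₀ S)) := CharDual.flip r
  have hsec : CharDual.map σ f ∘ₗ (CharDual.eval (swapOp σ) _ ∘ₗ CharDual.map σ p) =
      LinearMap.id := hr
  have heval : CharDual.map (swapOp σ) (CharDual.map σ p) ∘ₗ f = CharDual.eval σ X :=
    LinearMap.ext fun x => CharDual.ext fun φ =>
      DFunLike.congr_fun (DFunLike.congr_fun hr φ) x
  have hf : Function.Injective f := .of_comp (f := CharDual.map (swapOp σ) (CharDual.map σ p))
    (by rw [← LinearMap.coe_comp, heval]; exact CharDual.eval_injective)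
  have hinj : Module.Injective R (CharDual σ (CharDual (swapOp σ) (CharDual σ (X →₀ S)))) :=
    injective_doubleDual hF (swapOp σ)
  have hs := isShortExact_mkQ hf
  obtain ⟨t, ht⟩ := (CharDual.isShortExact_map hs).exists_retraction hsec
  exact ⟨.of S (_ ⧸ LinearMap.range f), f, _, hs, (isFlat_iff_injective_charDual σ).2
    (idLE_zero_iff.1 ((idLE_of_injective hinj).of_retract _ t ht))⟩

theorem IsFlat.hasG [IsNoetherianRing R] [IsNoetherianRing S] (σ : R ≃+* Sᵐᵒᵖ)
    (hS : HasG S n k S) (hX : IsFlat S X) : HasG S n k X := by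
  refine hasG_of_forall_exists_isShortExact (P := fun V => IsFlat S V) (fun V hV => ?_)
    (.of S X) hX
  obtain ⟨W, f, g, hs, hW⟩ := exists_isShortExact_doubleDual_of_isFlat σ hV
  exact ⟨.of S (CharDual (swapOp σ) (CharDual σ (V →₀ S))), W, f, g, hs,
    (hS.finsupp V).doubleDual σ, hW⟩

end HasG

section InjectiveEnvelope

/-- The element `b` is an essential extension of `a`: every nonzero `c ≤ b` meets `a`. -/
def EssentialIn {α : Type*} [Lattice α] [OrderBot α] (a b : α) : Prop :=
  a ≤ b ∧ ∀ c ≤ b, Disjoint c a → c = ⊥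

section Lattice

variable {α : Type*} [CompleteLattice α] [IsCompactlyGenerated α]

theorem exists_maximal_essentialIn (a : α) : ∃ b, Maximal (EssentialIn a) b := by
  obtain ⟨b, -, hb⟩ := zorn_le_nonempty₀ {b | EssentialIn a b} (fun s hs hchain b₀ hb₀ =>
    ⟨sSup s, ⟨(hs hb₀).1.trans (le_sSup hb₀), fun c hc hca => Disjoint.eq_bot_of_le
      (hchain.directedOn.disjoint_sSup_right.2 fun b hb => disjoint_iff.2 <|
        (hs hb).2 _ inf_le_right (hca.mono_left inf_le_left)) hc⟩,
      fun _ => le_sSup⟩) a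
    ⟨le_rfl, fun c hc hca => hca.eq_bot_of_le hc⟩
  exact ⟨b, hb⟩

theorem exists_maximal_disjoint (b : α) : ∃ k, Maximal (fun k => Disjoint k b) k := by
  obtain ⟨k, -, hk⟩ := zorn_le_nonempty₀ {k | Disjoint k b} (fun s hs hchain _ _ =>
    ⟨sSup s, hchain.directedOn.disjoint_sSup_left.2 hs, fun _ => le_sSup⟩) ⊥ disjoint_bot_left
  exact ⟨k, hk⟩

end Lattice

variable {S : Type u} [Ring S] {X E Y Z : Type u} [AddCommGroup X] [Module S X]
  [AddCommGroup E] [Module S E] [AddCommGroup Y] [Module S Y] [AddCommGroup Z] [Module S Z]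

/-- A maximal essential extension `B` of `A` inside an injective module is a retract: with `K`
maximal among the submodules disjoint from `B`, the inclusion of `B` extends to `t : E ⧸ K → E`,
whose range is again essential over `A` and hence equal to `B`. -/
theorem exists_retraction_of_maximal_essentialIn (hE : Module.Injective S E) {A B : Submodule S E}
    (hB : Maximal (EssentialIn A) B) : ∃ ρ : E →ₗ[S] B, ρ ∘ₗ B.subtype = LinearMap.id := by
  obtain ⟨K, hK⟩ := exists_maximal_disjoint B
  obtain ⟨h, hh⟩ := exists_comp_eq_of_baer (.of_injective hE) (K.mkQ ∘ₗ B.subtype) B.subtype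
    fun b hb => Submodule.disjoint_def.1 hK.prop b ((Submodule.Quotient.mk_eq_zero K).1 hb) b.2
  let t : E →ₗ[S] E := h ∘ₗ K.mkQ
  have ht (b : E) (hb : b ∈ B) : t b = b := DFunLike.congr_fun hh ⟨b, hb⟩
  have hKt : K ≤ LinearMap.ker t := by
    rw [← K.ker_mkQ]
    exact LinearMap.ker_le_ker_comp _ _
  have hcomap (C : Submodule S E) (hC : Disjoint C B) : C.comap t ≤ K := by
    refine hK.2 (Submodule.disjoint_def.2 fun b hb hbB => ?_)
      (hKt.trans (LinearMap.ker_le_comap t))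
    rw [Submodule.mem_comap, ht b hbB] at hb
    exact Submodule.disjoint_def.1 hC b hb hbB
  have hess : EssentialIn A (LinearMap.range t) := by
    refine ⟨fun a ha => ⟨a, ht a (hB.prop.1 ha)⟩, fun C hC hCA => ?_⟩
    have hCB : Disjoint C B :=
      disjoint_iff.2 (hB.prop.2 _ inf_le_right (hCA.mono_left inf_le_left))
    rw [← Submodule.map_comap_eq_of_le hC, eq_bot_iff, Submodule.map_le_iff_le_comap]
    exact (hcomap C hCB).trans hKt
  have hrange : LinearMap.range t ≤ B := hB.2 hess fun b hb => ⟨b, ht b hb⟩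
  exact ⟨t.codRestrict B fun x => hrange ⟨x, rfl⟩,
    LinearMap.ext fun b => Subtype.ext (ht b b.2)⟩

theorem isInjectiveEnvelope_of_essential {f : X →ₗ[S] E} (hE : Module.Injective S E)
    (hf : Function.Injective f) (hess : ∀ C, Disjoint C (LinearMap.range f) → C = ⊥) :
    IsInjectiveEnvelope S f := by
  have hinj (u : E →ₗ[S] E) (hu : u ∘ₗ f = f) : Function.Injective u := by
    refine LinearMap.ker_eq_bot.1 (hess _ (Submodule.disjoint_def.2 ?_))
    rintro _ hx ⟨x, rfl⟩
    exact (DFunLike.congr_fun hu x).symm.trans hx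
  refine ⟨hE, fun E' _ _ hE' g => (Module.Baer.of_injective hE').extension_property f hf g,
    fun u hu => ⟨hinj u hu, fun x => ?_⟩⟩
  obtain ⟨v, hv⟩ := (Module.Baer.of_injective hE).extension_property u (hinj u hu) LinearMap.id
  have hvf : v ∘ₗ f = f := by
    rw [← hu, ← LinearMap.comp_assoc, hv, LinearMap.id_comp, hu]
  exact ⟨v x, hinj v hvf (DFunLike.congr_fun hv (v x))⟩

theorem exists_isInjectiveEnvelope (S : Type u) [Ring S] (X : Type u) [AddCommGroup X]
    [Module S X] : ∃ (E : ModuleCat.{u} S) (f : X →ₗ[S] E),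
      Function.Injective f ∧ IsInjectiveEnvelope S f := by
  obtain ⟨E, i, hE, hi⟩ := exists_injective_embedding S X
  obtain ⟨B, hB⟩ := exists_maximal_essentialIn (LinearMap.range i)
  obtain ⟨ρ, hρ⟩ := exists_retraction_of_maximal_essentialIn hE hB
  let f : X →ₗ[S] B := i.codRestrict B fun x => hB.prop.1 ⟨x, rfl⟩
  have hf : Function.Injective f := fun x y hxy => hi (congrArg Subtype.val hxy)
  refine ⟨.of S B, f, hf, isInjectiveEnvelope_of_essential
    (idLE_zero_iff.1 ((idLE_of_injective hE).of_retract B.subtype ρ hρ)) hf fun C hC => ?_⟩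
  refine Submodule.map_injective_of_injective B.injective_subtype
    ((hB.prop.2 _ (Submodule.map_subtype_le B C) ?_).trans (Submodule.map_bot _).symm)
  rw [show i = B.subtype ∘ₗ f from rfl, LinearMap.range_comp]
  exact Submodule.disjoint_map B.injective_subtype hC

theorem IsInjectiveEnvelope.range_subtype {f : X →ₗ[S] E} (h : IsInjectiveEnvelope S f) :
    IsInjectiveEnvelope S (LinearMap.range f).subtype where
  injective := h.injective
  factors _ _ _ hE' g := (Module.Baer.of_injective hE').extension_property _
    Subtype.val_injective g
  left_minimal u hu := h.left_minimal u
    (LinearMap.ext fun x => DFunLike.congr_fun hu ⟨f x, x, rfl⟩)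

theorem IsInjectiveEnvelope.exists_retract {f : X →ₗ[S] E} {g : E →ₗ[S] Z}
    (hf : IsInjectiveEnvelope S f) (h : IsShortExact f g) {E' Z' : Type u} [AddCommGroup E']
    [Module S E'] [AddCommGroup Z'] [Module S Z'] {f' : X →ₗ[S] E'} {g' : E' →ₗ[S] Z'}
    (hE' : Module.Injective S E') (h' : IsShortExact f' g') :
    (∃ (α : E →ₗ[S] E') (β : E' →ₗ[S] E), β ∘ₗ α = LinearMap.id) ∧
      ∃ (s : Z →ₗ[S] Z') (r : Z' →ₗ[S] Z), r ∘ₗ s = LinearMap.id := by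
  obtain ⟨α, hα⟩ := hf.factors E' hE' f'
  obtain ⟨β, hβ⟩ := (Module.Baer.of_injective hf.injective).extension_property f' h'.1 f
  have hfix : (β ∘ₗ α) ∘ₗ f = f := by rw [LinearMap.comp_assoc, hα, hβ]
  let w := LinearEquiv.ofBijective (β ∘ₗ α) (hf.left_minimal _ hfix)
  let β' : E' →ₗ[S] E := w.symm.toLinearMap ∘ₗ β
  have hβα (x : E) : β' (α x) = x := w.symm_apply_apply x
  have hβ' : β' ∘ₗ f' = f := LinearMap.ext fun x => by
    rw [← hα]
    exact hβα (f x)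
  obtain ⟨s, hs⟩ := h.exists_desc (g' ∘ₗ α) (by
    rw [LinearMap.comp_assoc, hα, h'.comp_eq_zero])
  obtain ⟨r, hr⟩ := h'.exists_desc (g ∘ₗ β') (by
    rw [LinearMap.comp_assoc, hβ', h.comp_eq_zero])
  refine ⟨⟨α, β', LinearMap.ext hβα⟩, s, r, LinearMap.ext fun z => ?_⟩
  obtain ⟨x, rfl⟩ := h.2.2 z
  calc r (s (g x)) = r (g' (α x)) := congrArg r (DFunLike.congr_fun hs x)
    _ = g (β' (α x)) := DFunLike.congr_fun hr (α x)
    _ = g x := by rw [hβα]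

end InjectiveEnvelope

namespace MinimalInjectiveCoresolution

variable {S : Type u} [Ring S] {X : Type u} [AddCommGroup X] [Module S X]

protected theorem nonempty (S : Type u) [Ring S] (X : Type u) [AddCommGroup X] [Module S X] :
    Nonempty (MinimalInjectiveCoresolution S X) := by
  have hex (Y : ModuleCat.{u} S) : ∃ (E Y' : ModuleCat.{u} S) (f : Y →ₗ[S] E) (g : E →ₗ[S] Y'),
      IsShortExact f g ∧ IsInjectiveEnvelope S f := by
    obtain ⟨E, f, hf, hE⟩ := exists_isInjectiveEnvelope S Y
    exact ⟨E, .of S (E ⧸ LinearMap.range f), f, _, isShortExact_mkQ hf, hE⟩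
  choose env next e q hs henv using hex
  let Y (j : ℕ) : ModuleCat.{u} S := Nat.rec (.of S X) (fun _ => next) j
  have hker (j : ℕ) (x) : e (Y (j + 1)) (q (Y j) x) = 0 ↔ x ∈ Set.range (e (Y j)) := by
    rw [map_eq_zero_iff _ (hs (Y (j + 1))).1]
    exact (hs (Y j)).2.1 x
  exact ⟨{
    E := fun j => env (Y j)
    ε := e (Y 0)
    d := fun j => e (Y (j + 1)) ∘ₗ q (Y j)
    injective_ε := (hs _).1
    exact_zero := hker 0
    exact_succ := fun j x => by
      change _ ↔ x ∈ Set.range (e (Y (j + 1)) ∘ q (Y j))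
      rw [(hs (Y j)).2.2.range_comp]
      exact hker (j + 1) x
    envelope_zero := henv _
    envelope_succ := fun j => by
      rw [LinearMap.range_comp_of_range_eq_top _ (LinearMap.range_eq_top.2 (hs (Y j)).2.2)]
      exact (henv (Y (j + 1))).range_subtype }⟩

variable (C : MinimalInjectiveCoresolution S X)

/-- The `j`-th cosyzygy of `X` in a minimal injective coresolution. -/
def cosyzygy : ℕ → ModuleCat.{u} S
  | 0 => .of S X
  | j + 1 => .of S (LinearMap.range (C.d j))

/-- The inclusion of the `j`-th cosyzygy into the `j`-th term. -/
def incl : ∀ j, C.cosyzygy j →ₗ[S] C.E j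
  | 0 => C.ε
  | j + 1 => (LinearMap.range (C.d j)).subtype

theorem isInjectiveEnvelope_incl : ∀ j, IsInjectiveEnvelope S (C.incl j)
  | 0 => C.envelope_zero
  | j + 1 => C.envelope_succ j

theorem isShortExact_incl (j : ℕ) :
    IsShortExact (Z := C.cosyzygy (j + 1)) (C.incl j) (C.d j).rangeRestrict := by
  have hexact : Function.Exact (C.incl j) (C.d j) := by
    cases j with
    | zero => exact C.exact_zero
    | succ j =>
      rw [LinearMap.exact_iff, (C.exact_succ j).linearMap_ker_eq]
      exact (Submodule.range_subtype _).symm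
  refine ⟨?_, fun x => Subtype.ext_iff.trans (hexact x), LinearMap.surjective_rangeRestrict _⟩
  cases j with
  | zero => exact C.injective_ε
  | succ j => exact Subtype.val_injective

variable {C} {n k : ℕ}

theorem hasG_cosyzygy {j : ℕ} (h : ∀ i < n, FlatDimLE S (k + i) (C.E (j + i))) :
    HasG S n k (C.cosyzygy j) := by
  induction n generalizing j k with
  | zero => trivial
  | succ n ih =>
    refine ⟨C.E j, C.cosyzygy (j + 1), C.incl j, _, (C.isInjectiveEnvelope_incl j).injective,
      h 0 (by lia), C.isShortExact_incl j, ih fun i hi => ?_⟩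
    rw [add_right_comm, add_assoc, add_right_comm j, add_assoc j]
    exact h (i + 1) (by lia)

theorem flatDimLE_E {j : ℕ} (h : HasG S n k (C.cosyzygy j)) :
    ∀ i < n, FlatDimLE S (k + i) (C.E (j + i)) := by
  induction n generalizing j k with
  | zero => exact fun i hi => absurd hi (by lia)
  | succ n ih =>
    obtain ⟨E, X', f, g, hE, hEk, hs, hX'⟩ := h
    obtain ⟨⟨α, β, hβα⟩, s, r, hrs⟩ :=
      (C.isInjectiveEnvelope_incl j).exists_retract (C.isShortExact_incl j) hE hs
    rintro (_ | i) hi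
    · exact hEk.of_retract α β hβα
    · have := ih (hX'.of_retract s r hrs) i (by lia)
      rwa [add_right_comm, add_assoc, add_right_comm j, add_assoc j] at this

end MinimalInjectiveCoresolution

theorem isG_iff_hasG {S : Type u} [Ring S] {X : Type u} [AddCommGroup X] [Module S X] {n k : ℕ} :
    IsG S n k X ↔ HasG S n k X := by
  constructor
  · rintro ⟨C, hC⟩
    exact C.hasG_cosyzygy (j := 0) fun i hi => by rw [zero_add]; exact hC i hi
  · intro h
    obtain ⟨C⟩ := MinimalInjectiveCoresolution.nonempty S X
    refine ⟨C, fun i hi => ?_⟩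
    have := C.flatDimLE_E (j := 0) h i hi
    rwa [zero_add] at this

section Tower

variable {R S : Type u} [Ring R] [Ring S] {σ : R ≃+* Sᵐᵒᵖ}

section Lifting

variable {N W V Z : Type u} [AddCommGroup N] [Module S N] [AddCommGroup W] [Module R W]
  [AddCommGroup V] [Module R V] [AddCommGroup Z] [Module R Z]

/-- Dualizing, `W* → N**` splits because its kernel `V*` is injective; composing `N → N**` with a
section and transposing gives a retraction `W → N*`. -/
theorem IsShortExact.exists_section_of_charDual {i : CharDual σ N →ₗ[R] W} {q : W →ₗ[R] V}
    (h : IsShortExact i q) (hV : IsFlat R V) : ∃ s : V →ₗ[R] W, q ∘ₗ s = LinearMap.id := by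
  have hdual := CharDual.isShortExact_map (σ := swapOp σ) h
  obtain ⟨r, hr⟩ := hdual.exists_retraction_of_injective
    ((isFlat_iff_injective_charDual (swapOp σ)).1 hV)
  obtain ⟨t, ht⟩ := hdual.exists_section hr
  refine h.exists_section (r := CharDual.flip (t ∘ₗ CharDual.eval σ N)) ?_
  exact LinearMap.ext fun φ => CharDual.ext fun x =>
    DFunLike.congr_fun (DFunLike.congr_fun ht (CharDual.eval σ N x)) φ

theorem IsShortExact.exists_lift_of_charDual {i : CharDual σ N →ₗ[R] W} {q : W →ₗ[R] Z}
    (h : IsShortExact i q) (hV : IsFlat R V) (φ : V →ₗ[R] Z) : ∃ ψ : V →ₗ[R] W, q ∘ₗ ψ = φ := by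
  obtain ⟨s, hs⟩ := (FiberProduct.isShortExact_fst φ h).exists_section_of_charDual hV
  exact ⟨FiberProduct.snd φ q ∘ₗ s, LinearMap.ext fun v =>
    (s v).2.symm.trans (congrArg φ (DFunLike.congr_fun hs v))⟩

end Lifting

/-- `G` is a `j`-th syzygy of `C`, computed with flat modules. -/
inductive IsSyzygy : ℕ → ModuleCat.{u} R → ModuleCat.{u} R → Prop
  | zero (C : ModuleCat.{u} R) : IsSyzygy 0 C C
  | succ {j : ℕ} {G V Y C : ModuleCat.{u} R} (f : G →ₗ[R] V) (g : V →ₗ[R] Y)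
      (hV : IsFlat R V) (hs : IsShortExact f g) (h : IsSyzygy j Y C) : IsSyzygy (j + 1) G C

variable {n k j : ℕ}

theorem IsSyzygy.hasG [IsNoetherianRing R] [IsNoetherianRing S] (σ : R ≃+* Sᵐᵒᵖ)
    (hR : HasG R n k R) {G C : ModuleCat.{u} R} (h : IsSyzygy j G C) (hj : j ≤ n) :
    HasG R j k G := by
  induction h with
  | zero => trivial
  | succ f g hV hs _ ih =>
    exact hs.hasG_left ((hV.hasG (swapOp σ) hR).mono hj le_rfl)
      ((ih (by lia)).mono le_rfl k.le_succ)

namespace MinimalInjectiveCoresolution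

variable {N : Type u} [AddCommGroup N] [Module S N] (C : MinimalInjectiveCoresolution S N)

/-- The dual of the `j`-th cosyzygy. For varying `j` these are the syzygies of `N*` in the flat
resolution `⋯ → (C.E 1)* → (C.E 0)* → N* → 0`. -/
abbrev dualCosyzygy (σ : R ≃+* Sᵐᵒᵖ) (j : ℕ) : ModuleCat.{u} R :=
  .of R (CharDual σ (C.cosyzygy j))

theorem isShortExact_dualCosyzygy (σ : R ≃+* Sᵐᵒᵖ) (j : ℕ) :
    IsShortExact (X := C.dualCosyzygy σ (j + 1)) (Z := C.dualCosyzygy σ j)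
      (CharDual.map σ (C.d j).rangeRestrict) (CharDual.map σ (C.incl j)) :=
  CharDual.isShortExact_map (C.isShortExact_incl j)

theorem isFlat_dual_E [IsNoetherianRing S] (σ : R ≃+* Sᵐᵒᵖ) (j : ℕ) :
    IsFlat R (CharDual σ (C.E j)) :=
  (idLE_zero_iff.2 (C.isInjectiveEnvelope_incl j).injective).flatDimLE_charDual σ

variable {C} in
theorem idLE_dualCosyzygy (hN : IsFlat S N) (hC : ∀ i < n, FlatDimLE S (k + i) (C.E i))
    (hj : j ≤ n) : IdLE R (k + j) (C.dualCosyzygy σ j) := by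
  induction j with
  | zero => exact idLE_of_injective ((isFlat_iff_injective_charDual σ).1 hN)
  | succ j ih =>
    exact (C.isShortExact_dualCosyzygy σ j).idLE_left
      (((flatDimLE_iff_idLE_charDual σ).1 (hC j hj)).mono (k + j).le_succ) (ih (by lia))

end MinimalInjectiveCoresolution

theorem exists_injective_charDual_of_hasG [IsNoetherianRing S] (σ : R ≃+* Sᵐᵒᵖ)
    (hS : HasG S n k S) (X : Type u) [AddCommGroup X] [Module R X] :
    ∃ (N : ModuleCat.{u} S) (f : X →ₗ[R] CharDual σ N),
      Function.Injective f ∧ IsFlat S N ∧ IsG S n k N := by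
  obtain ⟨p, hN, hp⟩ := exists_isFlat_surjective S (CharDual (swapOp σ) X)
  exact ⟨.of S (CharDual (swapOp σ) X →₀ S), CharDual.map σ p ∘ₗ CharDual.eval (swapOp σ) X,
    (CharDual.map_injective hp).comp CharDual.eval_injective, hN, isG_iff_hasG.2 (hS.finsupp _)⟩

theorem IsSyzygy.exists_extension [IsNoetherianRing S] {N : Type u} [AddCommGroup N] [Module S N]
    (C : MinimalInjectiveCoresolution S N) {G X X' : ModuleCat.{u} R}
    {f : X →ₗ[R] C.dualCosyzygy σ 0} {g : C.dualCosyzygy σ 0 →ₗ[R] X'} (hs : IsShortExact f g)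
    (h : IsSyzygy j G X) :
    ∃ (G' : ModuleCat.{u} R) (i : C.dualCosyzygy σ (j + 1) →ₗ[R] G') (β : G' →ₗ[R] G),
      IsShortExact i β ∧ IsSyzygy (j + 1) G' X' := by
  induction h with
  | zero X =>
    have hC := C.isShortExact_dualCosyzygy σ 0
    obtain ⟨i, β, hiβ⟩ := hC.exists_ker_comp hs
    exact ⟨.of R (LinearMap.ker _), i, β, hiβ, .succ (V := .of R (CharDual σ (C.E 0))) _ _
      (C.isFlat_dual_E σ 0) (isShortExact_ker (hs.2.2.comp hC.2.2)) (.zero X')⟩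
  | @succ j G V Y X f g hV hVY _ ih =>
    obtain ⟨Y', i, β, hiβ, hY'⟩ := ih hs
    obtain ⟨ψ, hψ⟩ := hiβ.exists_lift_of_charDual hV g
    obtain ⟨G', e, e', a, b, hee', hab⟩ := hiβ.horseshoe
      (C.isShortExact_dualCosyzygy σ (j + 1)) hVY hψ
    exact ⟨G', a, b, hab, .succ (V := .of R (CharDual σ (C.E (j + 1)) × V)) e e'
      (isShortExact_inl_snd.flatDimLE_middle (d := 0) (C.isFlat_dual_E σ _) hV) hee' hY'⟩

/-- A surjection from an `i`-th syzygy onto `M` with kernel of injective dimension at most `i + k`: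
the rows of the tower over `M`. -/
structure SyzygyCover (n k : ℕ) (M : Type u) [AddCommGroup M] [Module R M] (i : ℕ) where
  G : ModuleCat.{u} R
  X : ModuleCat.{u} R
  p : G →ₗ[R] M
  surjective : Function.Surjective p
  isSyzygy : IsSyzygy i G X
  idLE : i ≤ n → IdLE R (i + k) (LinearMap.ker p)

theorem SyzygyCover.exists_next [IsNoetherianRing S] (σ : R ≃+* Sᵐᵒᵖ) (hS : HasG S n k S)
    {M : Type u} [AddCommGroup M] [Module R M] (s : SyzygyCover (R := R) n k M j) :
    ∃ (t : SyzygyCover (R := R) n k M (j + 1)) (β : t.G →ₗ[R] s.G),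
      Function.Surjective β ∧ s.p ∘ₗ β = t.p := by
  obtain ⟨N, f, hf, hN, C, hC⟩ := exists_injective_charDual_of_hasG σ hS s.X
  obtain ⟨G', i, β, hiβ, hG'⟩ := s.isSyzygy.exists_extension C
    (X' := .of R (CharDual σ N ⧸ LinearMap.range f)) (isShortExact_mkQ hf)
  obtain ⟨a, b, hab⟩ := hiβ.exists_ker_comp (isShortExact_ker s.surjective)
  refine ⟨⟨G', _, s.p ∘ₗ β, s.surjective.comp hiβ.2.2, hG', fun hj => hab.idLE_middle ?_ ?_⟩,
    β, hiβ.2.2, rfl⟩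
  · exact (MinimalInjectiveCoresolution.idLE_dualCosyzygy hN hC hj).mono (by lia)
  · exact (s.idLE (by lia)).mono (by lia)

theorem exists_tower [IsNoetherianRing R] [IsNoetherianRing S] (σ : R ≃+* Sᵐᵒᵖ)
    (hR : HasG R n k R) (hS : HasG S n k S) (M : Type u) [AddCommGroup M] [Module R M] :
    ∃ (G : ℕ → ModuleCat.{u} R) (p : ∀ j, G j →ₗ[R] M) (β : ∀ j, G (j + 1) →ₗ[R] G j), ∀ j,
      Function.Surjective (p j) ∧ Function.Surjective (β j) ∧ p j ∘ₗ β j = p (j + 1) ∧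
      (j ≤ n → IdLE R (j + k) (LinearMap.ker (p j)) ∧ IsG R j k (G j)) := by
  choose next β hβ hp using
    fun (i : ℕ) (s : SyzygyCover (R := R) n k M i) => s.exists_next σ hS
  let s₀ : SyzygyCover (R := R) n k M 0 :=
    { G := .of R M
      X := .of R M
      p := LinearMap.id
      surjective := Function.surjective_id
      isSyzygy := .zero _
      idLE := fun _ => idLE_of_injective (by
        rw [LinearMap.ker_id]
        exact ⟨fun _ _ _ _ _ _ _ _ _ => ⟨0, fun _ => Subsingleton.elim _ _⟩⟩) }
  let s (i : ℕ) : SyzygyCover (R := R) n k M i := Nat.rec s₀ next i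
  exact ⟨fun j => (s j).G, fun j => (s j).p, fun j => β j (s j), fun j => ⟨(s j).surjective,
    hβ j (s j), hp j (s j),
    fun hj => ⟨(s j).idLE hj, isG_iff_hasG.2 ((s j).isSyzygy.hasG σ hR hj)⟩⟩⟩

end Tower

section Approximation

variable {R S : Type u} [Ring R] [Ring S] [IsNoetherianRing R] [IsNoetherianRing S] {n k : ℕ}

theorem exists_tower_isShortExact_left (σ : R ≃+* Sᵐᵒᵖ) (hR : HasG R n k R) (hS : HasG S n k S)
    (M : Type u) [AddCommGroup M] [Module R M] :
    ∃ (I G : ℕ → ModuleCat.{u} R) (f : ∀ j, M →ₗ[R] I j) (g : ∀ j, I j →ₗ[R] G j)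
      (α : ∀ j, I (j + 1) →ₗ[R] I j) (β : ∀ j, G (j + 1) →ₗ[R] G j), ∀ j,
      IsShortExact (f j) (g j) ∧ (j ≤ n → IdLE R (j + k) (I j) ∧ IsG R j k (G j)) ∧
      Function.Surjective (α j) ∧ Function.Surjective (β j) ∧
      α j ∘ₗ f (j + 1) = f j ∧ β j ∘ₗ g (j + 1) = g j ∘ₗ α j := by
  obtain ⟨E, f₀, hE, hf₀⟩ := exists_injective_embedding R M
  obtain ⟨G, p, β, h⟩ := exists_tower σ hR hS (E ⧸ LinearMap.range f₀)
  let q : E →ₗ[R] E ⧸ LinearMap.range f₀ := (LinearMap.range f₀).mkQ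
  have hq : IsShortExact f₀ q := isShortExact_mkQ hf₀
  have hpβ (j : ℕ) : p j ∘ₗ β j = p (j + 1) := (h j).2.2.1
  let α (j : ℕ) : FiberProduct q (p (j + 1)) →ₗ[R] FiberProduct q (p j) :=
    FiberProduct.lift (FiberProduct.fst _ _) (β j ∘ₗ FiberProduct.snd _ _)
      (LinearMap.ext fun x => x.2.trans (DFunLike.congr_fun (hpβ j) x.1.2).symm)
  have hα (j : ℕ) : Function.Surjective (α j) := by
    rintro ⟨⟨e, y⟩, hey : q e = p j y⟩
    obtain ⟨x, rfl⟩ := (h j).2.1 y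
    exact ⟨⟨(e, x), hey.trans (DFunLike.congr_fun (hpβ j) x)⟩, rfl⟩
  refine ⟨fun j => .of R (FiberProduct q (p j)), G, fun j => _, fun j => FiberProduct.snd q (p j),
    α, β, fun j => ⟨FiberProduct.isShortExact_snd (p j) hq, fun hj => ⟨?_, ((h j).2.2.2 hj).2⟩,
      hα j, (h j).2.1, ?_, rfl⟩⟩
  · exact (FiberProduct.isShortExact_fst q (isShortExact_ker (h j).1)).idLE_middle
      ((h j).2.2.2 hj).1 (idLE_of_injective hE)
  · exact LinearMap.ext fun m => Subtype.ext (Prod.ext rfl (map_zero (β j)))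

theorem exists_tower_isShortExact_right (σ : R ≃+* Sᵐᵒᵖ) (hR : HasG R n k R) (hS : HasG S n k S)
    (M : Type u) [AddCommGroup M] [Module R M] :
    ∃ (I G : ℕ → ModuleCat.{u} R) (f : ∀ j, I j →ₗ[R] G j) (g : ∀ j, G j →ₗ[R] M)
      (α : ∀ j, I (j + 1) →ₗ[R] I j) (β : ∀ j, G (j + 1) →ₗ[R] G j), ∀ j,
      IsShortExact (f j) (g j) ∧ (j ≤ n → IdLE R (j + k) (I j) ∧ IsG R j k (G j)) ∧
      Function.Surjective (α j) ∧ Function.Surjective (β j) ∧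
      β j ∘ₗ f (j + 1) = f j ∘ₗ α j ∧ g j ∘ₗ β j = g (j + 1) := by
  obtain ⟨G, p, β, h⟩ := exists_tower σ hR hS M
  have hpβ (j : ℕ) (x : G (j + 1)) : p j (β j x) = p (j + 1) x :=
    DFunLike.congr_fun (h j).2.2.1 x
  refine ⟨fun j => .of R (LinearMap.ker (p j)), G, fun j => (LinearMap.ker (p j)).subtype, p,
    fun j => (β j).restrict fun x hx => (hpβ j x).trans hx, β, fun j =>
    ⟨isShortExact_ker (h j).1, (h j).2.2.2, ?_, (h j).2.1, rfl, (h j).2.2.1⟩⟩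
  rintro ⟨y, hy : p j y = 0⟩
  obtain ⟨x, rfl⟩ := (h j).2.1 y
  exact ⟨⟨x, (hpβ j x).symm.trans hy⟩, rfl⟩

end Approximation

theorem hasG_mulOpposite_self {R : Type u} [Ring R] {n k : ℕ} (h : HasG Rᵐᵒᵖ n k R) :
    HasG Rᵐᵒᵖ n k Rᵐᵒᵖ := by
  let e : Rᵐᵒᵖ ≃ₗ[Rᵐᵒᵖ] R := { MulOpposite.opAddEquiv.symm with map_smul' := fun _ _ => rfl }
  exact h.of_retract e.toLinearMap e.symm.toLinearMap (LinearMap.ext e.symm_apply_apply)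

end AuslanderType

open AuslanderType CategoryTheory in
theorem theorem6p2_general (R : Type u) [Ring R] [IsNoetherianRing R] [IsNoetherianRing Rᵐᵒᵖ]
    (n k : ℕ) (hleft : IsG R n k R) (hright : IsG Rᵐᵒᵖ n k R)
    (M : Type u) [AddCommGroup M] [Module R M] :
    (∃ (I G : ℕ → ModuleCat.{u} R)
        (f : ∀ j, M →ₗ[R] I j) (g : ∀ j, I j →ₗ[R] G j)
        (α : ∀ j, I (j + 1) →ₗ[R] I j) (β : ∀ j, G (j + 1) →ₗ[R] G j),
      ∀ i, 1 ≤ i → i + 1 ≤ n →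
        (∀ j, j = i ∨ j = i + 1 →
          IsShortExact (f j) (g j) ∧
          HasInjectiveDimensionLE (I j) (j + k) ∧ IsG R j k (G j)) ∧
        Function.Surjective (α i) ∧ Function.Surjective (β i) ∧
        α i ∘ₗ f (i + 1) = f i ∧ β i ∘ₗ g (i + 1) = g i ∘ₗ α i) ∧
    (∃ (I G : ℕ → ModuleCat.{u} R)
        (f : ∀ j, I j →ₗ[R] G j) (g : ∀ j, G j →ₗ[R] M)
        (α : ∀ j, I (j + 1) →ₗ[R] I j) (β : ∀ j, G (j + 1) →ₗ[R] G j),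
      ∀ i, 1 ≤ i → i + 1 ≤ n →
        (∀ j, j = i ∨ j = i + 1 →
          IsShortExact (f j) (g j) ∧
          HasInjectiveDimensionLE (I j) (j + k) ∧ IsG R j k (G j)) ∧
        Function.Surjective (α i) ∧ Function.Surjective (β i) ∧
        β i ∘ₗ f (i + 1) = f i ∘ₗ α i ∧ g i ∘ₗ β i = g (i + 1)) := by
  have hR : HasG R n k R := isG_iff_hasG.1 hleft
  have hS : HasG Rᵐᵒᵖ n k Rᵐᵒᵖ := hasG_mulOpposite_self (isG_iff_hasG.1 hright)
  constructor
  · obtain ⟨I, G, f, g, α, β, h⟩ := exists_tower_isShortExact_left (.opOp R) hR hS M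
    exact ⟨I, G, f, g, α, β, fun i _ hi =>
      ⟨fun j hj => ⟨(h j).1, (h j).2.1 (by lia)⟩, (h i).2.2⟩⟩
  · obtain ⟨I, G, f, g, α, β, h⟩ := exists_tower_isShortExact_right (.opOp R) hR hS M
    exact ⟨I, G, f, g, α, β, fun i _ hi =>
      ⟨fun j hj => ⟨(h j).1, (h j).2.1 (by lia)⟩, (h i).2.2⟩⟩

open AuslanderType CategoryTheory in
theorem theorem6p2 {A : Type*} [CommRing A] [IsArtinianRing A]
    (R : Type u) [Ring R] [Algebra A R] [Module.Finite A R] (n k : ℕ)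
    (hleft : IsG R n k R) (hright : IsG Rᵐᵒᵖ n k R)
    (M : Type u) [AddCommGroup M] [Module R M] :
    (∃ (I G : ℕ → ModuleCat.{u} R)
        (f : ∀ j, M →ₗ[R] I j) (g : ∀ j, I j →ₗ[R] G j)
        (α : ∀ j, I (j + 1) →ₗ[R] I j) (β : ∀ j, G (j + 1) →ₗ[R] G j),
      ∀ i, 1 ≤ i → i + 1 ≤ n →
        (∀ j, j = i ∨ j = i + 1 →
          IsShortExact (f j) (g j) ∧
          HasInjectiveDimensionLE (I j) (j + k) ∧ IsG R j k (G j)) ∧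
        Function.Surjective (α i) ∧ Function.Surjective (β i) ∧
        α i ∘ₗ f (i + 1) = f i ∧ β i ∘ₗ g (i + 1) = g i ∘ₗ α i) ∧
    (∃ (I G : ℕ → ModuleCat.{u} R)
        (f : ∀ j, I j →ₗ[R] G j) (g : ∀ j, G j →ₗ[R] M)
        (α : ∀ j, I (j + 1) →ₗ[R] I j) (β : ∀ j, G (j + 1) →ₗ[R] G j),
      ∀ i, 1 ≤ i → i + 1 ≤ n →
        (∀ j, j = i ∨ j = i + 1 →
          IsShortExact (f j) (g j) ∧
          HasInjectiveDimensionLE (I j) (j + k) ∧ IsG R j k (G j)) ∧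
        Function.Surjective (α i) ∧ Function.Surjective (β i) ∧
        β i ∘ₗ f (i + 1) = f i ∘ₗ α i ∧ g i ∘ₗ β i = g (i + 1)) := by
  have : IsNoetherianRing R := .of_finite A R
  have : Module.Finite A Rᵐᵒᵖ := .equiv (MulOpposite.opLinearEquiv A)
  have : IsNoetherianRing Rᵐᵒᵖ := .of_finite A Rᵐᵒᵖ
  exact theorem6p2_general R n k hleft hright M
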